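/- **Theorem.** Let $K$ be a field of characteristic different from $2$. Let $\mathcal P=\mathrm{qgr}\,\widetilde{\mathrm{Alt}^!}$ be the symmetric operad over $K$ (reduced, i.e. without elements of arity $0$) generated by a symmetric binary operation $a_1,a_2\mapsto a_1\cdot a_2$ and a skew-symmetric binary operation $a_1,a_2\mapsto[a_1,a_2]$ subject to the relations $$[[a_1,a_2],a_3]+[[a_1,a_3],a_2]=0,$$ $$[a_1\cdot a_2,a_3]=a_1\cdot[a_2,a_3]+[a_1,a_3]\cdot a_2,$$ $$(a_1\cdot a_2)\cdot a_3=a_1\cdot(a_2\cdot a_3),$$ that is, the quotient of the free operad by the operadic ideal generated by these relations. Then for every $n\ge 1$ $$\dim_K\mathcal P(n)=2^n-n .$$ Moreover, for monomials $c_1,\dots,c_k$ with pairwise disjoint sets of arguments, write $\mathrm{st}(c_1,\dots,c_k)=c_{i_1}\cdot(c_{i_2}\cdot(\cdots(c_{i_{k-1}}\cdot c_{i_k})\cdots))$, where $c_{i_1},\dots,c_{i_k}$ are the factors ordered by their minimal arguments. Then a basis of $\mathcal P(n)$ is formed by the classes of the monomials $$\mathrm{st}([a_{i_1},a_{i_2}],\dots,[a_{i_{2s-1}},a_{i_{2s}}],a_{j_1},\dots,a_{j_k}),\qquad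 n=2s+k,\ s\ge 0,$$ with $i_1<\dots<i_{2s}$, $j_1<\dots<j_k$, $\{i_1,\dots,i_{2s}\}\sqcup\{j_1,\dots,j_k\}=\{1,\dots,n\}$, together with the classes of the monomials $$\mathrm{st}([a_{i_1},a_{i_2}],\dots,[a_{i_{2s-3}},a_{i_{2s-2}}],[a_{i_{2s-1}},[a_{i_{2s}},a_{i_{2s+1}}]],a_{j_1},\dots,a_{j_k}),\qquad n=2s+1+k,\ s\ge 1,$$ with $i_1<\dots<i_{2s+1}$, $j_1<\dots<j_k$, $\{i_1,\dots,i_{2s+1}\}\sqcup\{j_1,\dots,j_k\}=\{1,\dots,n\}$. -/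

import Mathlib

/-!
# The operad `qgr` of the modified dual alternative operad

Symmetric operads are used in the coordinate-free form: a collection assigns a vector space to each
finite set of inputs, bijections act by renaming the inputs, and the partial composition at an
input `a` is a map `P(A) ⊗ P(B) → P((A ∖ {a}) ⊔ B)`. The arity `n` component of `P` is its value on
`Fin n`, on which the symmetric group acts through the bijections of `Fin n`.
-/

namespace DualAlt

/-- Planar binary trees whose leaves carry labels in `α` and whose internal vertices carry one of
two binary operations, the product `a · b` (`mul`) and the bracket `[a, b]` (`br`). -/
inductive Term (α : Type) : Type
  | leaf : α → Term α
  | mul : Term α → Term α → Term α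
  | br : Term α → Term α → Term α

namespace Term

variable {α β : Type}

/-- The labels of the leaves, from left to right. -/
def leaves : Term α → List α
  | leaf a => [a]
  | mul s t => s.leaves ++ t.leaves
  | br s t => s.leaves ++ t.leaves

/-- Simultaneous substitution of trees for the leaves. -/
def subst (f : α → Term β) : Term α → Term β
  | leaf a => f a
  | mul s t => mul (s.subst f) (t.subst f)
  | br s t => br (s.subst f) (t.subst f)

theorem leaves_subst (f : α → Term β) (t : Term α) :
    (t.subst f).leaves = t.leaves.flatMap (fun a => (f a).leaves) := by
  induction t with
  | leaf a => simp [subst, leaves]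
  | mul s t hs ht => simp [subst, leaves, hs, ht]
  | br s t hs ht => simp [subst, leaves, hs, ht]

/-- Every label of `α` occurs on exactly one leaf. -/
def IsMultilinear (t : Term α) : Prop := t.leaves.Nodup ∧ ∀ a : α, a ∈ t.leaves

instance [Fintype α] [DecidableEq α] (t : Term α) : Decidable t.IsMultilinear :=
  inferInstanceAs (Decidable (_ ∧ _))

/-- Renaming of the leaves. -/
def rename (f : α → β) (t : Term α) : Term β := t.subst (fun a => leaf (f a))

theorem leaves_rename (f : α → β) (t : Term α) : (t.rename f).leaves = t.leaves.map f := by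
  simp only [rename, leaves_subst, leaves]
  exact (List.map_eq_flatMap).symm

theorem IsMultilinear.rename {t : Term α} (ht : t.IsMultilinear) (e : α ≃ β) :
    (t.rename e).IsMultilinear := by
  refine ⟨?_, fun b => ?_⟩
  · rw [leaves_rename]
    exact ht.1.map e.injective
  · rw [leaves_rename, List.mem_map]
    exact ⟨e.symm b, ht.2 _, by simp⟩

open Classical in
/-- Grafting: the leaf labelled `a` of `t` is replaced by the tree `s`. -/
noncomputable def graft (a : α) (t : Term α) (s : Term β) : Term ({x : α // x ≠ a} ⊕ β) :=
  t.subst (fun x => if h : x = a then s.rename Sum.inr else leaf (Sum.inl ⟨x, h⟩))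

theorem IsMultilinear.graft {t : Term α} {s : Term β} (ht : t.IsMultilinear)
    (hs : s.IsMultilinear) (a : α) : (Term.graft a t s).IsMultilinear := by
  classical
  unfold Term.graft
  refine ⟨?_, ?_⟩
  · rw [leaves_subst, List.nodup_flatMap]
    refine ⟨fun x _ => ?_, ht.1.imp ?_⟩
    · by_cases h : x = a
      · simp only [h, dite_true, leaves_rename]
        exact hs.1.map Sum.inr_injective
      · simp [h, leaves]
    · intro x y hxy
      by_cases hx : x = a <;> by_cases hy : y = a
      · exact absurd (hx.trans hy.symm) hxy
      · simp [Function.onFun, List.Disjoint, hx, hy, leaves, leaves_rename]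
      · simp [Function.onFun, List.Disjoint, hx, hy, leaves, leaves_rename]
      · simp [Function.onFun, List.Disjoint, hx, hy, leaves, hxy]
  · intro z
    rw [leaves_subst, List.mem_flatMap]
    rcases z with ⟨x, hx⟩ | b
    · exact ⟨x, ht.2 x, by simp [hx, leaves]⟩
    · exact ⟨a, ht.2 a, by simp [leaves_rename, hs.2 b]⟩

end Term

/-- Tree monomials with input set `α`. (There are none if `α` is empty or infinite.) -/
abbrev Tree (α : Type) : Type := {t : Term α // t.IsMultilinear}

/-- The component, with input set `α`, of the free symmetric operad over `K` on two binary
operations without symmetries (the symmetries are imposed together with the relations). -/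
abbrev Free (K : Type*) [Field K] (α : Type) := Tree α →₀ K

section FreeOperad

variable {K : Type*} [Field K] {α β : Type}

/-- The action of bijections of the input sets on the free operad. -/
noncomputable def Free.rename (e : α ≃ β) : Free K α →ₗ[K] Free K β :=
  Finsupp.lmapDomain K K (fun t : Tree α => (⟨t.1.rename e, t.2.rename e⟩ : Tree β))

/-- The partial composition `x ∘ₐ y` of the free operad: the bilinear extension of grafting. -/
noncomputable def Free.comp (a : α) :
    Free K α →ₗ[K] Free K β →ₗ[K] Free K ({x : α // x ≠ a} ⊕ β) :=
  Finsupp.linearCombination K (fun t : Tree α => Finsupp.lmapDomain K K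
    (fun s : Tree β => (⟨Term.graft a t.1 s.1, t.2.graft s.2 a⟩ : Tree ({x : α // x ≠ a} ⊕ β))))

/-- A tree monomial as an element of the free operad. -/
noncomputable def Free.mono (K : Type*) [Field K] (t : Term α) (ht : t.IsMultilinear) : Free K α :=
  Finsupp.single (⟨t, ht⟩ : Tree α) 1

/-- Membership in the operadic ideal of the free operad generated by a collection `R` of elements:
the smallest collection of subspaces that contains `R` and is stable under bijections of the inputs
and under partial compositions with arbitrary elements on either side. -/
inductive InIdeal (R : ∀ α : Type, Set (Free K α)) : ∀ α : Type, Free K α → Prop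
  | gen {α : Type} {x : Free K α} (hx : x ∈ R α) : InIdeal R α x
  | zero (α : Type) : InIdeal R α 0
  | add {α : Type} {x y : Free K α} (hx : InIdeal R α x) (hy : InIdeal R α y) :
      InIdeal R α (x + y)
  | smul {α : Type} (c : K) {x : Free K α} (hx : InIdeal R α x) : InIdeal R α (c • x)
  | rename {α β : Type} (e : α ≃ β) {x : Free K α} (hx : InIdeal R α x) :
      InIdeal R β (Free.rename e x)
  | comp_left {α β : Type} (a : α) {x : Free K α} (hx : InIdeal R α x) (y : Free K β) :
      InIdeal R ({z : α // z ≠ a} ⊕ β) (Free.comp a x y)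
  | comp_right {α β : Type} (a : α) (x : Free K α) {y : Free K β} (hy : InIdeal R β y) :
      InIdeal R ({z : α // z ≠ a} ⊕ β) (Free.comp a x y)

/-- The component of the operadic ideal generated by `R`. -/
def ideal (R : ∀ α : Type, Set (Free K α)) (α : Type) : Submodule K (Free K α) where
  carrier := {x | InIdeal R α x}
  zero_mem' := InIdeal.zero α
  add_mem' := InIdeal.add
  smul_mem' c _ hx := InIdeal.smul c hx

end FreeOperad

open Term in
/-- The defining relations. The labels `0, 1, 2` stand for `a₁, a₂, a₃`. -/
inductive QgrRel (K : Type*) [Field K] : ∀ α : Type, Set (Free K α)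
  /-- `a₁ · a₂ = a₂ · a₁` -/
  | mul_symm : QgrRel K (Fin 2)
      (Free.mono K (mul (leaf 0) (leaf 1)) (by decide)
        - Free.mono K (mul (leaf 1) (leaf 0)) (by decide))
  /-- `[a₁, a₂] = -[a₂, a₁]` -/
  | br_skew : QgrRel K (Fin 2)
      (Free.mono K (br (leaf 0) (leaf 1)) (by decide)
        + Free.mono K (br (leaf 1) (leaf 0)) (by decide))
  /-- `[[a₁, a₂], a₃] + [[a₁, a₃], a₂] = 0` -/
  | br_br : QgrRel K (Fin 3)
      (Free.mono K (br (br (leaf 0) (leaf 1)) (leaf 2)) (by decide)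
        + Free.mono K (br (br (leaf 0) (leaf 2)) (leaf 1)) (by decide))
  /-- `[a₁ · a₂, a₃] = a₁ · [a₂, a₃] + [a₁, a₃] · a₂` -/
  | leibniz : QgrRel K (Fin 3)
      (Free.mono K (br (mul (leaf 0) (leaf 1)) (leaf 2)) (by decide)
        - (Free.mono K (mul (leaf 0) (br (leaf 1) (leaf 2))) (by decide)
          + Free.mono K (mul (br (leaf 0) (leaf 2)) (leaf 1)) (by decide)))
  /-- `(a₁ · a₂) · a₃ = a₁ · (a₂ · a₃)` -/
  | mul_assoc : QgrRel K (Fin 3)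
      (Free.mono K (mul (mul (leaf 0) (leaf 1)) (leaf 2)) (by decide)
        - Free.mono K (mul (leaf 0) (mul (leaf 1) (leaf 2))) (by decide))

/-- The arity `n` component of the operad generated by a symmetric product and a skew-symmetric
bracket subject to the relations above: the quotient of the free operad by the operadic ideal
generated by them. -/
abbrev Qgr (K : Type*) [Field K] (n : ℕ) := Free K (Fin n) ⧸ ideal (QgrRel K) (Fin n)

/-- The class in `Qgr K n` of a tree monomial. -/
noncomputable def Qgr.mono (K : Type*) [Field K] {n : ℕ} (t : Term (Fin n))
    (ht : t.IsMultilinear) : Qgr K n :=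
  (ideal (QgrRel K) (Fin n)).mkQ (Free.mono K t ht)

/-! ### Standardised products -/

namespace Term

/-- The minimal argument of a monomial. -/
def minArg {α : Type} [LinearOrder α] : Term α → α
  | leaf a => a
  | mul s t => min s.minArg t.minArg
  | br s t => min s.minArg t.minArg

/-- The right-normed product `c₁ · (c₂ · (⋯ (cₖ₋₁ · cₖ)))` of a non-empty list. -/
def rightProd {α : Type} : (l : List (Term α)) → l ≠ [] → Term α
  | [c], _ => c
  | c :: d :: l, _ => mul c (rightProd (d :: l) (by simp))

/-- The factors ordered according to their minimal arguments. -/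
def sortFactors {α : Type} [LinearOrder α] (l : List (Term α)) : List (Term α) :=
  l.insertionSort (fun s t => s.minArg ≤ t.minArg)

/-- The bracket monomials `[a₁, a₂], [a₃, a₄], …` of a list of arguments; if the number of
arguments is odd and at least three, the last one is `[aₘ₋₂, [aₘ₋₁, aₘ]]`. -/
def brackets {α : Type} : List α → List (Term α)
  | [] => []
  | [a] => [leaf a]
  | [a, b, c] => [br (leaf a) (br (leaf b) (leaf c))]
  | a :: b :: l => br (leaf a) (leaf b) :: brackets l

/-- The factors of the basis monomial of a set `I = {i₁ < ⋯ < iₘ}` with complement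
`{j₁ < ⋯ < jₖ}`: the brackets on the arguments in `I`, and the remaining single arguments. -/
def factors {n : ℕ} (I : Finset (Fin n)) : List (Term (Fin n)) :=
  brackets (I.sort (· ≤ ·)) ++ (Iᶜ.sort (· ≤ ·)).map leaf

end Term

end DualAlt

/-!
The theorem is proved by passing from the operad to algebras over it. Substituting arbitrary
monomials, with possibly repeated labels, into the elements of the operadic ideal gives an ideal of
the free non-associative algebra with two operations whose multilinear part is contained in the
operadic ideal (`multilinearPart_subst_mem`, `algIdeal_le_comap`).
So the quotient `FreeAlg` is an honest algebra over the operad, that is, it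
satisfies the relations for all arguments (`FreeAlg.isQgr`), and it maps its multilinear monomials
to their classes in `Qgr K n`. Conversely, an element of the operadic ideal vanishes in every
algebra over the operad (`IsQgr.eval_eq_zero`). Both halves of the theorem thus become statements
about algebras.

*Spanning.* Adjoin a unit with `[1, x] = 0`, so that the product becomes that of a commutative ring.
By the first relation, `[[x, y], z]` is totally skew-symmetric. Two consequences use that `2` is
invertible: `[[[x, y], z], t] = 0` (`br_br_br`), and `[x, z] · [y, t]` is totally skew-symmetric
(`mul_swap`), the latter because the double bracket `[[x · y, z], t]` is skew-symmetric in `z` and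
`t`. Hence the products `bracketProd` of brackets are skew-symmetric in all their arguments
(`bracketProd_perm`), the product of two such products of odd length vanishes, and the span of the
elements `bracketProd l · s` is stable under both operations (`mul_mem_normalSpan`,
`br_mem_normalSpan`). Sorting `l` at the cost of a sign leaves the basis monomials.

*Independence.* Pairs `(f, p)` of an even and an odd element of an exterior algebra, with
`(f, p) · (g, q) = (f g, p g + f q)` and `[(f, p), (g, q)] = (p q, 2 ε p q)` for a fixed vector `ε`,
form an algebra over the operad (`model_isQgr`). Evaluate `aᵢ` at `(0, ξᵢ)` for `i ∈ I` and at the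
unit `(1, 0)` for `i ∉ I`. The even component of the value of the basis monomial of `J` is then `0`
for `J ≠ I` (`eval_basisTree_of_ne`), whereas for `J = I` it is the product of the `ξᵢ`, with an
additional factor `2 ε` if the cardinality of `I` is odd (`eval_basisTree_self`).
-/

namespace DualAlt

/-! ### Algebras over the operad -/

namespace Term

variable {α β γ : Type}

theorem subst_subst (f : α → Term β) (g : β → Term γ) (t : Term α) :
    (t.subst f).subst g = t.subst (fun a => (f a).subst g) := by
  induction t with
  | leaf a => rfl
  | mul s t hs ht => simp [subst, hs, ht]
  | br s t hs ht => simp [subst, hs, ht]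

section Eval

variable {K : Type*} [Field K] {A : Type*} [AddCommGroup A] [Module K A]
variable (m b : A →ₗ[K] A →ₗ[K] A)

/-- The value of a tree monomial in a vector space with two bilinear operations, the leaves being
evaluated by `v`. -/
def eval (v : α → A) : Term α → A
  | leaf a => v a
  | mul s t => m (s.eval v) (t.eval v)
  | br s t => b (s.eval v) (t.eval v)

theorem eval_subst (v : β → A) (f : α → Term β) (t : Term α) :
    (t.subst f).eval m b v = t.eval m b (fun a => (f a).eval m b v) := by
  induction t with
  | leaf a => rfl
  | mul s t hs ht => simp [subst, eval, hs, ht]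
  | br s t hs ht => simp [subst, eval, hs, ht]

theorem eval_congr {v w : α → A} {t : Term α} (h : ∀ a ∈ t.leaves, v a = w a) :
    t.eval m b v = t.eval m b w := by
  induction t with
  | leaf a => exact h a (by simp [leaves])
  | mul s t hs ht =>
    simp only [leaves, List.mem_append] at h
    simp [eval, hs fun a ha => h a (Or.inl ha), ht fun a ha => h a (Or.inr ha)]
  | br s t hs ht =>
    simp only [leaves, List.mem_append] at h
    simp [eval, hs fun a ha => h a (Or.inl ha), ht fun a ha => h a (Or.inr ha)]

/-- If the label `a` occurs once in `t`, then the value of `t` is linear in the value of `a`. -/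
theorem exists_linearMap_eval_update [DecidableEq α] (v : α → A) (a : α) (t : Term α)
    (hn : t.leaves.Nodup) (ha : a ∈ t.leaves) :
    ∃ L : A →ₗ[K] A, ∀ u, t.eval m b (Function.update v a u) = L u := by
  have key : ∀ s : Term α, a ∉ s.leaves → ∀ u,
      s.eval m b (Function.update v a u) = s.eval m b v := fun s hs u =>
    eval_congr m b fun x hx => Function.update_of_ne (ne_of_mem_of_not_mem hx hs) _ _
  induction t with
  | leaf x =>
    obtain rfl : a = x := by simpa [leaves] using ha
    exact ⟨LinearMap.id, fun u => by simp [eval]⟩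
  | mul s t hs ht =>
    simp only [leaves, List.mem_append, List.nodup_append] at hn ha
    rcases ha with ha | ha
    · obtain ⟨L, hL⟩ := hs hn.1 ha
      exact ⟨m.flip (t.eval m b v) ∘ₗ L, fun u => by
        simp [eval, hL, key t (fun h => hn.2.2 a ha a h rfl)]⟩
    · obtain ⟨L, hL⟩ := ht hn.2.1 ha
      exact ⟨m (s.eval m b v) ∘ₗ L, fun u => by
        simp [eval, hL, key s (fun h => hn.2.2 a h a ha rfl)]⟩
  | br s t hs ht =>
    simp only [leaves, List.mem_append, List.nodup_append] at hn ha
    rcases ha with ha | ha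
    · obtain ⟨L, hL⟩ := hs hn.1 ha
      exact ⟨b.flip (t.eval m b v) ∘ₗ L, fun u => by
        simp [eval, hL, key t (fun h => hn.2.2 a ha a h rfl)]⟩
    · obtain ⟨L, hL⟩ := ht hn.2.1 ha
      exact ⟨b (s.eval m b v) ∘ₗ L, fun u => by
        simp [eval, hL, key s (fun h => hn.2.2 a h a ha rfl)]⟩

end Eval

end Term

/-- Two bilinear operations, a product `m` and a bracket `b`, make `A` an algebra over the
operad: the defining relations hold for all arguments in `A`. -/
structure IsQgr {K : Type*} [Field K] {A : Type*} [AddCommGroup A] [Module K A]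
    (m b : A →ₗ[K] A →ₗ[K] A) : Prop where
  mul_symm : ∀ x y, m x y = m y x
  br_skew : ∀ x y, b x y = -b y x
  br_br : ∀ x y z, b (b x y) z + b (b x z) y = 0
  leibniz : ∀ x y z, b (m x y) z = m x (b y z) + m (b x z) y
  mul_assoc : ∀ x y z, m (m x y) z = m x (m y z)

section EvalFree

variable {K : Type*} [Field K] {A : Type*} [AddCommGroup A] [Module K A]
variable {α β : Type} (m b : A →ₗ[K] A →ₗ[K] A)

/-- The linear extension of `Term.eval` to the free operad. -/
noncomputable def Free.eval (v : α → A) : Free K α →ₗ[K] A :=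
  Finsupp.linearCombination K (fun t : Tree α => t.1.eval m b v)

@[simp]
theorem Free.eval_single (v : α → A) (t : Tree α) (c : K) :
    Free.eval m b v (Finsupp.single t c) = c • t.1.eval m b v := by
  simp [Free.eval]

@[simp]
theorem Free.eval_mono (v : α → A) (t : Term α) (ht : t.IsMultilinear) :
    Free.eval m b v (Free.mono K t ht) = t.eval m b v := by
  simp [Free.mono]

theorem Free.eval_rename (v : β → A) (e : α ≃ β) (x : Free K α) :
    Free.eval m b v (Free.rename e x) = Free.eval m b (v ∘ e) x := by
  have : Free.eval m b v ∘ₗ Free.rename e = Free.eval m b (v ∘ e) := by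
    ext t
    simp [Free.rename, Finsupp.mapDomain_single, Term.rename, Term.eval_subst]
    rfl
  exact LinearMap.congr_fun this x

theorem Free.comp_single_single (a : α) (t : Tree α) (s : Tree β) :
    Free.comp a (Finsupp.single t (1 : K)) (Finsupp.single s 1) =
      Finsupp.single ⟨Term.graft a t.1 s.1, t.2.graft s.2 a⟩ 1 := by
  simp [Free.comp, Finsupp.mapDomain_single]

open Classical in
theorem Term.subst_graft {γ : Type} (a : α) (t : Term α) (s : Term β)
    (g : {x : α // x ≠ a} ⊕ β → Term γ) :
    (Term.graft a t s).subst g = t.subst (fun x =>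
      if h : x = a then s.subst (g ∘ Sum.inr) else g (Sum.inl ⟨x, h⟩)) := by
  rw [Term.graft, Term.subst_subst]
  congr 1
  funext x
  by_cases h : x = a
  · simp [h, Term.rename, Term.subst_subst, Term.subst, Function.comp_def]
  · simp [h, Term.subst]

open Classical in
theorem Term.eval_graft (a : α) (t : Term α) (s : Term β) (v : {x : α // x ≠ a} ⊕ β → A) :
    (Term.graft a t s).eval m b v = t.eval m b (fun x =>
      if h : x = a then s.eval m b (v ∘ Sum.inr) else v (Sum.inl ⟨x, h⟩)) := by
  rw [Term.graft, Term.eval_subst]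
  congr 1
  funext x
  by_cases h : x = a
  · simp [h, Term.rename, Term.eval_subst, Term.eval, Function.comp_def]
  · simp [h, Term.eval]

/-- The relations of the operad hold in each of its algebras. -/
theorem IsQgr.eval_eq_zero {m b : A →ₗ[K] A →ₗ[K] A} (h : IsQgr m b) {x : Free K α}
    (hx : InIdeal (QgrRel K) α x) (v : α → A) : Free.eval m b v x = 0 := by
  classical
  induction hx with
  | gen hx =>
    cases hx with
    | mul_symm => simp [Term.eval, h.mul_symm (v 0) (v 1)]
    | br_skew => simp [Term.eval, h.br_skew (v 0) (v 1)]
    | br_br => simpa [Term.eval] using h.br_br (v 0) (v 1) (v 2)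
    | leibniz => simp [Term.eval, h.leibniz (v 0) (v 1) (v 2)]
    | mul_assoc => simp [Term.eval, h.mul_assoc (v 0) (v 1) (v 2)]
  | zero => simp
  | add _ _ hx hy => simp [hx, hy]
  | smul c _ hx => simp [hx]
  | rename e _ hx => rw [Free.eval_rename, hx]
  | @comp_left α β a x _ y hx =>
    induction y using Finsupp.induction_linear with
    | zero => simp
    | add y z hy hz => simp [hy, hz]
    -- the value of `x ∘ₐ s` at `v` is that of `x` with `a` evaluated at the value of `s`
    | single s c =>
      have : Free.eval m b v ∘ₗ (Free.comp a).flip (Finsupp.single s 1) =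
          Free.eval m b (fun z : α => if h : z = a then s.1.eval m b (v ∘ Sum.inr)
            else v (Sum.inl ⟨z, h⟩)) := by
        ext t
        simp [Free.comp_single_single, Term.eval_graft]
      rw [← mul_one c, ← smul_eq_mul, ← Finsupp.smul_single, map_smul, map_smul]
      have h2 := LinearMap.congr_fun this x
      simp only [LinearMap.comp_apply, LinearMap.flip_apply] at h2
      rw [h2, hx, smul_zero]
  | @comp_right α β a x y _ hy =>
    induction x using Finsupp.induction_linear with
    | zero => simp
    | add y z hy hz => simp [hy, hz]
    -- the value of `t ∘ₐ y` at `v` depends linearly on the value of `y`, since `a` occurs once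
    -- in `t`
    | single t c =>
      obtain ⟨L, hL⟩ := Term.exists_linearMap_eval_update m b
        (fun z : α => if h : z = a then 0 else v (Sum.inl ⟨z, h⟩)) a t.1 t.2.1 (t.2.2 a)
      have : Free.eval m b v ∘ₗ Free.comp a (Finsupp.single t 1) =
          L ∘ₗ Free.eval m b (v ∘ Sum.inr) := by
        ext s
        simp only [LinearMap.comp_apply, Finsupp.lsingle_apply, Free.comp_single_single,
          Free.eval_single, one_smul, Term.eval_graft, ← hL]
        congr 1
        funext z
        by_cases hz : z = a
        · subst hz; simp
        · simp [hz]
      rw [← mul_one c, ← smul_eq_mul, ← Finsupp.smul_single, map_smul, LinearMap.smul_apply,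
        map_smul]
      have h2 := LinearMap.congr_fun this y
      simp only [LinearMap.comp_apply] at h2
      rw [h2, hy, map_zero, smul_zero]

end EvalFree

/-! ### The free algebra over a quotient operad -/

section FreeAlgebra

variable {K : Type*} [Field K] {α β γ : Type}

/-- Substitution of tree monomials, not necessarily with disjoint sets of labels, into an element
of the free operad. -/
noncomputable def Free.subst (g : β → Term γ) : Free K β →ₗ[K] (Term γ →₀ K) :=
  Finsupp.lmapDomain K K (fun t : Tree β => t.1.subst g)

@[simp]
theorem Free.subst_single (g : β → Term γ) (t : Tree β) (c : K) :
    Free.subst g (Finsupp.single t c) = Finsupp.single (t.1.subst g) c := by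
  simp [Free.subst, Finsupp.mapDomain_single]

open Classical in
/-- The projection of the free non-associative algebra on its multilinear part. -/
noncomputable def multilinearPart : (Term γ →₀ K) →ₗ[K] Free K γ :=
  Finsupp.linearCombination K (fun t => if h : t.IsMultilinear then Free.mono K t h else 0)

theorem multilinearPart_single {t : Term γ} (ht : t.IsMultilinear) :
    multilinearPart (Finsupp.single t (1 : K)) = Free.mono K t ht := by
  simp [multilinearPart, ht]

theorem multilinearPart_single_of_not {t : Term γ} (ht : ¬t.IsMultilinear) (c : K) :
    multilinearPart (Finsupp.single t c) = 0 := by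
  simp [multilinearPart, ht]

theorem multilinearPart_subst_eq_zero {g : β → Term γ}
    (h : ∀ t : Tree β, ¬(t.1.subst g).IsMultilinear) (x : Free K β) :
    multilinearPart (Free.subst g x) = 0 := by
  induction x using Finsupp.induction_linear with
  | zero => simp
  | add x y hx hy => simp [hx, hy]
  | single t c => rw [Free.subst_single, multilinearPart_single_of_not (h t)]

/-- A monomial whose labels satisfy `p` is a monomial in the subtype of `p`. -/
theorem Term.exists_rename_val (p : γ → Prop) (t : Term γ) (h : ∀ c ∈ t.leaves, p c) :
    ∃ s : Term {c // p c}, s.rename Subtype.val = t := by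
  induction t with
  | leaf c => exact ⟨leaf ⟨c, h c (by simp [leaves])⟩, rfl⟩
  | mul s t hs ht =>
    simp only [leaves, List.mem_append] at h
    obtain ⟨s', hs'⟩ := hs fun a ha => h a (Or.inl ha)
    obtain ⟨t', ht'⟩ := ht fun a ha => h a (Or.inr ha)
    exact ⟨mul s' t', by rw [← hs', ← ht']; rfl⟩
  | br s t hs ht =>
    simp only [leaves, List.mem_append] at h
    obtain ⟨s', hs'⟩ := hs fun a ha => h a (Or.inl ha)
    obtain ⟨t', ht'⟩ := ht fun a ha => h a (Or.inr ha)
    exact ⟨br s' t', by rw [← hs', ← ht']; rfl⟩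

/-- A monomial without repeated labels is a multilinear monomial in the set of its labels. -/
theorem Term.exists_tree_rename_val (t : Term γ) (h : t.leaves.Nodup) :
    ∃ s : Tree {c // c ∈ t.leaves}, s.1.rename Subtype.val = t := by
  obtain ⟨s, hs⟩ := t.exists_rename_val (· ∈ t.leaves) fun _ => id
  have hl : s.leaves.map Subtype.val = t.leaves := by rw [← leaves_rename, hs]
  refine ⟨⟨s, List.Nodup.of_map Subtype.val (hl.symm ▸ h), fun c => ?_⟩, hs⟩
  have hc : c.1 ∈ s.leaves.map Subtype.val := hl.symm ▸ c.2
  obtain ⟨d, hd, hdc⟩ := List.mem_map.1 hc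
  rwa [← Subtype.ext hdc]

variable (R : ∀ α : Type, Set (Free K α))

/-- If arbitrary monomials are substituted into an element of an operadic ideal, the multilinear
part of the result is again in the ideal. One substitutes one monomial at a time by a partial
composition, until only a renaming of the inputs is left. -/
theorem multilinearPart_subst_mem [Finite β] {x : Free K β} (hx : x ∈ ideal R β)
    (g : β → Term γ) : multilinearPart (Free.subst g x) ∈ ideal R γ := by
  classical
  obtain ⟨k, hk⟩ : ∃ k, {a | ∀ c, g a ≠ Term.leaf c}.ncard = k := ⟨_, rfl⟩
  induction k using Nat.strong_induction_on generalizing β with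
  | _ k ih =>
  by_cases hg : ∀ a, ∃ c, g a = Term.leaf c
  · -- a renaming of the inputs by `f`: multilinearity is kept only if `f` is bijective
    choose f hf using hg
    obtain rfl : g = fun a => Term.leaf (f a) := funext hf
    by_cases hb : Function.Bijective f
    · have : multilinearPart ∘ₗ Free.subst (fun a => Term.leaf (f a)) =
          Free.rename (K := K) (Equiv.ofBijective f hb) := by
        ext1 t
        ext1
        simp only [LinearMap.comp_apply, Finsupp.lsingle_apply, Free.subst_single]
        refine (multilinearPart_single (t.2.rename (Equiv.ofBijective f hb))).trans ?_
        simp [Free.rename, Free.mono, Finsupp.mapDomain_single]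
      have h2 := LinearMap.congr_fun this x
      rw [LinearMap.comp_apply] at h2
      rw [h2]
      exact InIdeal.rename _ hx
    · rw [multilinearPart_subst_eq_zero]
      · exact Submodule.zero_mem _
      · rintro t ht
        have hl : (t.1.subst fun a => Term.leaf (f a)).leaves = t.1.leaves.map f :=
          Term.leaves_rename f t.1
        rw [Term.IsMultilinear, hl] at ht
        refine hb ⟨fun a a' h => ?_, fun c => ?_⟩
        · exact List.inj_on_of_nodup_map ht.1 (t.2.2 a) (t.2.2 a') h
        · obtain ⟨a, -, ha⟩ := List.mem_map.1 (ht.2 c)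
          exact ⟨a, ha⟩
  · push Not at hg
    obtain ⟨a, ha⟩ := hg
    by_cases hn : (g a).leaves.Nodup
    · -- graft `g a` at `a`, keeping its leaves as new inputs, and substitute the rest afterwards
      obtain ⟨s, hs⟩ := (g a).exists_tree_rename_val hn
      let g' : {z : β // z ≠ a} ⊕ {c // c ∈ (g a).leaves} → Term γ :=
        Sum.elim (fun z => g z) (fun c => Term.leaf c)
      have hgraft : Free.subst g ∘ₗ LinearMap.id =
          Free.subst g' ∘ₗ (Free.comp (K := K) a).flip (Finsupp.single s 1) := by
        ext1 t
        ext1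
        simp only [LinearMap.comp_apply, Finsupp.lsingle_apply, LinearMap.id_apply,
          LinearMap.flip_apply, Free.comp_single_single, Free.subst_single, Term.subst_graft]
        congr 2
        funext z
        by_cases hz : z = a
        · subst hz
          simp only [dite_true]
          exact hs.symm
        · simp [hz, g']
      have h2 := LinearMap.congr_fun hgraft x
      simp only [LinearMap.comp_apply, LinearMap.id_apply, LinearMap.flip_apply] at h2
      rw [h2]
      have hfin : Finite {c // c ∈ (g a).leaves} := List.finite_toSet _
      refine ih _ ?_ (InIdeal.comp_left a hx _) g' rfl
      have himg : {z | ∀ c, g' z ≠ Term.leaf c} =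
          Sum.inl '' (Subtype.val ⁻¹' {z | ∀ c, g z ≠ Term.leaf c}) := by
        ext z
        rcases z with z | c
        · simp [g']
        · simp [g']
      rw [himg, Set.ncard_image_of_injective _ Sum.inl_injective, ← hk,
        ← Set.ncard_image_of_injective _ Subtype.val_injective]
      refine Set.ncard_lt_ncard ⟨?_, fun hsub => ?_⟩ (Set.toFinite _)
      · rintro _ ⟨z, hz, rfl⟩
        exact hz
      · obtain ⟨z, -, hz⟩ := hsub ha
        exact z.2 hz
    · -- a label that is repeated in `g a` is repeated in the results of the substitution
      rw [multilinearPart_subst_eq_zero]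
      · exact Submodule.zero_mem _
      · rintro t ht
        rw [Term.IsMultilinear, Term.leaves_subst, List.nodup_flatMap] at ht
        exact hn (ht.1.1 a (t.2.2 a))

/-- The substitution instances of the elements of the operadic ideal generated by `R`; they form
the ideal by which the free algebra on `γ` over the quotient operad is a quotient of the free
non-associative algebra. -/
noncomputable def algIdeal (γ : Type) : Submodule K (Term γ →₀ K) :=
  Submodule.span K {y | ∃ (β : Type) (_ : Finite β) (x : Free K β) (g : β → Term γ),
    x ∈ ideal R β ∧ y = Free.subst g x}

variable {R}

theorem subst_mem_algIdeal [Finite β] {x : Free K β} (hx : x ∈ ideal R β) (g : β → Term γ) :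
    Free.subst g x ∈ algIdeal R γ :=
  Submodule.subset_span ⟨β, ‹_›, x, g, hx, rfl⟩

theorem algIdeal_le_comap :
    algIdeal R γ ≤ (ideal R γ).comap multilinearPart := by
  rw [algIdeal, Submodule.span_le]
  rintro _ ⟨β, _, x, g, hx, rfl⟩
  exact multilinearPart_subst_mem R hx g

/-- The bilinear operation on the free non-associative algebra given by a binary monomial. -/
noncomputable def binop (T : Tree (Fin 2)) :
    (Term γ →₀ K) →ₗ[K] (Term γ →₀ K) →ₗ[K] (Term γ →₀ K) :=
  Finsupp.linearCombination K (fun s => Finsupp.lmapDomain K K (fun t => T.1.subst ![s, t]))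

theorem binop_single_single (T : Tree (Fin 2)) (s t : Term γ) :
    binop T (Finsupp.single s (1 : K)) (Finsupp.single t 1) =
      Finsupp.single (T.1.subst ![s, t]) 1 := by
  simp [binop, Finsupp.mapDomain_single]

theorem binop_mem_left (T : Tree (Fin 2)) {x : Term γ →₀ K} (hx : x ∈ algIdeal R γ)
    (y : Term γ →₀ K) : binop T x y ∈ algIdeal R γ := by
  classical
  induction y using Finsupp.induction_linear with
  | zero => simp
  | add y z hy hz => rw [map_add]; exact Submodule.add_mem _ hy hz
  | single t c =>
    rw [← mul_one c, ← smul_eq_mul, ← Finsupp.smul_single, map_smul]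
    refine Submodule.smul_mem _ _ ?_
    revert x
    suffices h : algIdeal R γ ≤
        (algIdeal R γ).comap ((binop T).flip (Finsupp.single t (1 : K))) from
        fun _ hx => h hx
    conv_lhs => rw [algIdeal]
    rw [Submodule.span_le]
    rintro _ ⟨β, _, x, g, hx, rfl⟩
    -- the element is a substitution instance of the partial composition of `x` into `T`
    have : (binop T).flip (Finsupp.single t (1 : K)) ∘ₗ Free.subst g =
        Free.subst (Sum.elim (fun _ => t) g) ∘ₗ Free.comp 0 (Finsupp.single T 1) := by
      ext1 s
      ext1
      simp only [LinearMap.comp_apply, Finsupp.lsingle_apply, Free.subst_single,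
        LinearMap.flip_apply, Free.comp_single_single, Term.subst_graft, binop_single_single]
      congr 2
      funext z
      fin_cases z <;> simp
    have h2 := LinearMap.congr_fun this x
    simp only [LinearMap.comp_apply] at h2
    rw [SetLike.mem_coe, Submodule.mem_comap, h2]
    exact subst_mem_algIdeal (InIdeal.comp_right 0 _ hx) _

theorem binop_mem_right (T : Tree (Fin 2)) (x : Term γ →₀ K) {y : Term γ →₀ K}
    (hy : y ∈ algIdeal R γ) : binop T x y ∈ algIdeal R γ := by
  classical
  induction x using Finsupp.induction_linear with
  | zero => simp
  | add y z hy hz => rw [map_add]; exact Submodule.add_mem _ hy hz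
  | single t c =>
    rw [← mul_one c, ← smul_eq_mul, ← Finsupp.smul_single, map_smul]
    refine Submodule.smul_mem _ _ ?_
    revert y
    suffices h : algIdeal R γ ≤
        (algIdeal R γ).comap (binop T (Finsupp.single t (1 : K))) from
        fun _ hx => h hx
    conv_lhs => rw [algIdeal]
    rw [Submodule.span_le]
    rintro _ ⟨β, _, x, g, hx, rfl⟩
    -- the element is a substitution instance of the partial composition of `x` into `T`
    have : binop T (Finsupp.single t (1 : K)) ∘ₗ Free.subst g =
        Free.subst (Sum.elim (fun _ => t) g) ∘ₗ Free.comp 1 (Finsupp.single T 1) := by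
      ext1 s
      ext1
      simp only [LinearMap.comp_apply, Finsupp.lsingle_apply, Free.subst_single,
        Free.comp_single_single, Term.subst_graft, binop_single_single]
      congr 2
      funext z
      fin_cases z <;> simp
    have h2 := LinearMap.congr_fun this x
    simp only [LinearMap.comp_apply] at h2
    rw [SetLike.mem_coe, Submodule.mem_comap, h2]
    exact subst_mem_algIdeal (InIdeal.comp_right 1 _ hx) _

variable (R) in
/-- The free algebra on the set `γ` over the quotient of the free operad by the ideal generated
by `R`. -/
abbrev FreeAlg (γ : Type) := (Term γ →₀ K) ⧸ algIdeal R γ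

variable (R) in
/-- The operation of `FreeAlg R γ` given by a binary monomial. -/
noncomputable def FreeAlg.binop (T : Tree (Fin 2)) :
    FreeAlg R γ →ₗ[K] FreeAlg R γ →ₗ[K] FreeAlg R γ :=
  (algIdeal R γ).liftQ
    (Submodule.mapQLinear (algIdeal R γ) (algIdeal R γ) ∘ₗ
      (DualAlt.binop T).codRestrict (Submodule.compatibleMaps (algIdeal R γ) (algIdeal R γ))
        fun x _ hy => binop_mem_right T x hy) <| by
    intro x hx
    rw [LinearMap.mem_ker]
    refine Submodule.linearMap_qext _ (LinearMap.ext fun y => ?_)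
    exact (Submodule.Quotient.mk_eq_zero _).2 (binop_mem_left T hx _)

variable (R) in
/-- The class of a monomial in the free algebra. -/
noncomputable def FreeAlg.mk (t : Term γ) : FreeAlg R γ :=
  (algIdeal R γ).mkQ (Finsupp.single t 1)

theorem FreeAlg.binop_mk (T : Tree (Fin 2)) (s t : Term γ) :
    FreeAlg.binop R T (FreeAlg.mk R s) (FreeAlg.mk R t) =
      FreeAlg.mk R (T.1.subst ![s, t]) := by
  simp only [FreeAlg.mk]
  rw [← binop_single_single]
  rfl

@[elab_as_elim]
theorem FreeAlg.induction {p : FreeAlg R γ → Prop} (mk : ∀ t, p (FreeAlg.mk R t))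
    (zero : p 0) (add : ∀ x y, p x → p y → p (x + y)) (smul : ∀ (c : K) x, p x → p (c • x))
    (x : FreeAlg R γ) : p x := by
  induction x using Submodule.Quotient.induction_on with
  | _ x =>
  induction x using Finsupp.induction_linear with
  | zero => exact zero
  | add x y hx hy => exact add _ _ hx hy
  | single t c =>
    rw [← mul_one c, ← smul_eq_mul, ← Finsupp.smul_single]
    exact smul c _ (mk t)

/-- The binary monomial `a₀ · a₁`. -/
def mulTree : Tree (Fin 2) := ⟨.mul (.leaf 0) (.leaf 1), by decide⟩

/-- The binary monomial `[a₀, a₁]`. -/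
def brTree : Tree (Fin 2) := ⟨.br (.leaf 0) (.leaf 1), by decide⟩

theorem FreeAlg.mk_eq_eval (t : Term γ) :
    FreeAlg.mk R t = t.eval (FreeAlg.binop R mulTree) (FreeAlg.binop R brTree)
      (fun c => FreeAlg.mk R (Term.leaf c)) := by
  induction t with
  | leaf c => rfl
  | mul s t hs ht => rw [Term.eval, ← hs, ← ht, binop_mk]; rfl
  | br s t hs ht => rw [Term.eval, ← hs, ← ht, binop_mk]; rfl

theorem FreeAlg.mkQ_subst_eq_zero [Finite β] {x : Free K β} (hx : x ∈ R β) (g : β → Term γ) :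
    (algIdeal R γ).mkQ (Free.subst g x) = 0 :=
  (Submodule.Quotient.mk_eq_zero _).2 (subst_mem_algIdeal (InIdeal.gen hx) g)

theorem FreeAlg.mkQ_subst_mono (g : β → Term γ) (t : Term β) (ht : t.IsMultilinear) :
    (algIdeal R γ).mkQ (Free.subst g (Free.mono K t ht)) = FreeAlg.mk R (t.subst g) := by
  simp [Free.mono, FreeAlg.mk]

variable (K) in
/-- The free algebra satisfies the defining relations for all arguments: on monomials they are
substitution instances of the relations, and they are multilinear. -/
theorem FreeAlg.isQgr (γ : Type) :
    IsQgr (FreeAlg.binop (γ := γ) (QgrRel K) mulTree) (FreeAlg.binop (QgrRel K) brTree) where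
  mul_symm x y := by
    induction x using FreeAlg.induction with
    | zero => simp
    | add x x' hx hx' => simp [hx, hx']
    | smul c x hx => simp [hx]
    | mk s =>
    induction y using FreeAlg.induction with
    | zero => simp
    | add x x' hx hx' => simp [hx, hx']
    | smul c x hx => simp [hx]
    | mk t =>
      have := FreeAlg.mkQ_subst_eq_zero (QgrRel.mul_symm (K := K)) ![s, t]
      simp only [map_sub, FreeAlg.mkQ_subst_mono] at this
      simp only [FreeAlg.binop_mk]
      exact sub_eq_zero.1 this
  br_skew x y := by
    induction x using FreeAlg.induction with
    | zero => simp
    | add x x' hx hx' => simp [hx, hx', add_comm]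
    | smul c x hx => simp [hx]
    | mk s =>
    induction y using FreeAlg.induction with
    | zero => simp
    | add x x' hx hx' => simp [hx, hx', add_comm]
    | smul c x hx => simp [hx]
    | mk t =>
      have := FreeAlg.mkQ_subst_eq_zero (QgrRel.br_skew (K := K)) ![s, t]
      simp only [map_add, FreeAlg.mkQ_subst_mono] at this
      simp only [FreeAlg.binop_mk]
      exact eq_neg_of_add_eq_zero_left this
  br_br x y z := by
    induction x using FreeAlg.induction with
    | zero => simp
    | add x x' hx hx' =>
      simp only [map_add, LinearMap.add_apply]
      linear_combination (norm := module) hx + hx'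
    | smul c x hx => simp only [map_smul, LinearMap.smul_apply, ← smul_add, hx, smul_zero]
    | mk s =>
    induction y using FreeAlg.induction with
    | zero => simp
    | add x x' hx hx' =>
      simp only [map_add, LinearMap.add_apply]
      linear_combination (norm := module) hx + hx'
    | smul c x hx => simp only [map_smul, LinearMap.smul_apply, ← smul_add, hx, smul_zero]
    | mk t =>
    induction z using FreeAlg.induction with
    | zero => simp
    | add x x' hx hx' =>
      simp only [map_add, LinearMap.add_apply]
      linear_combination (norm := module) hx + hx'
    | smul c x hx => simp only [map_smul, LinearMap.smul_apply, ← smul_add, hx, smul_zero]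
    | mk u =>
      have := FreeAlg.mkQ_subst_eq_zero (QgrRel.br_br (K := K)) ![s, t, u]
      simp only [map_add, FreeAlg.mkQ_subst_mono] at this
      simp only [FreeAlg.binop_mk]
      exact this
  leibniz x y z := by
    induction x using FreeAlg.induction with
    | zero => simp
    | add x x' hx hx' =>
      simp only [map_add, LinearMap.add_apply]
      linear_combination (norm := module) hx + hx'
    | smul c x hx => simp only [map_smul, LinearMap.smul_apply, hx, smul_add]
    | mk s =>
    induction y using FreeAlg.induction with
    | zero => simp
    | add x x' hx hx' =>
      simp only [map_add, LinearMap.add_apply]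
      linear_combination (norm := module) hx + hx'
    | smul c x hx => simp only [map_smul, LinearMap.smul_apply, hx, smul_add]
    | mk t =>
    induction z using FreeAlg.induction with
    | zero => simp
    | add x x' hx hx' =>
      simp only [map_add, LinearMap.add_apply]
      linear_combination (norm := module) hx + hx'
    | smul c x hx => simp only [map_smul, LinearMap.smul_apply, hx, smul_add]
    | mk u =>
      have := FreeAlg.mkQ_subst_eq_zero (QgrRel.leibniz (K := K)) ![s, t, u]
      simp only [map_add, map_sub, FreeAlg.mkQ_subst_mono] at this
      simp only [FreeAlg.binop_mk]
      exact sub_eq_zero.1 this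
  mul_assoc x y z := by
    induction x using FreeAlg.induction with
    | zero => simp
    | add x x' hx hx' => simp only [map_add, LinearMap.add_apply, hx, hx']
    | smul c x hx => simp only [map_smul, LinearMap.smul_apply, hx]
    | mk s =>
    induction y using FreeAlg.induction with
    | zero => simp
    | add x x' hx hx' => simp only [map_add, LinearMap.add_apply, hx, hx']
    | smul c x hx => simp only [map_smul, LinearMap.smul_apply, hx]
    | mk t =>
    induction z using FreeAlg.induction with
    | zero => simp
    | add x x' hx hx' => simp only [map_add, hx, hx']
    | smul c x hx => simp only [map_smul, hx]
    | mk u =>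
      have := FreeAlg.mkQ_subst_eq_zero (QgrRel.mul_assoc (K := K)) ![s, t, u]
      simp only [map_sub, FreeAlg.mkQ_subst_mono] at this
      simp only [FreeAlg.binop_mk]
      exact sub_eq_zero.1 this

variable (R) in
/-- The multilinear part of the free algebra on `γ` is the component of the quotient operad. -/
noncomputable def FreeAlg.toQuotient (γ : Type) :
    FreeAlg R γ →ₗ[K] Free K γ ⧸ ideal R γ :=
  Submodule.mapQ _ _ multilinearPart algIdeal_le_comap

theorem FreeAlg.toQuotient_mk {t : Term γ} (ht : t.IsMultilinear) :
    FreeAlg.toQuotient R γ (FreeAlg.mk R t) = (ideal R γ).mkQ (Free.mono K t ht) := by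
  rw [← multilinearPart_single ht]
  rfl

end FreeAlgebra

/-! ### Brackets on unital commutative algebras -/

/-- The axioms of the bracket on a unital commutative algebra over the operad; the axioms of the
product are those of a commutative ring. -/
structure IsQgrBracket {K : Type*} [Field K] {A : Type*} [CommRing A] [Algebra K A]
    (b : A →ₗ[K] A →ₗ[K] A) : Prop where
  skew : ∀ x y, b x y = -b y x
  br_br : ∀ x y z, b (b x y) z + b (b x z) y = 0
  leibniz : ∀ x y z, b (x * y) z = x * b y z + b x z * y

section Unital

variable {K : Type*} [Field K] {A : Type*} [CommRing A] [Algebra K A]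
variable {b : A →ₗ[K] A →ₗ[K] A}

theorem eq_zero_of_eq_neg (h2 : (2 : K) ≠ 0) {x : A} (h : x = -x) : x = 0 := by
  have : (2 : K) • x = 0 := by rw [two_smul]; nth_rewrite 1 [h]; simp
  exact (smul_eq_zero.1 this).resolve_left h2

namespace IsQgrBracket

theorem swap_right (h : IsQgrBracket b) (x y z : A) : b (b x y) z = -b (b x z) y :=
  eq_neg_of_add_eq_zero_left (h.br_br x y z)

theorem swap_left (h : IsQgrBracket b) (x y z : A) : b (b x y) z = -b (b y x) z := by
  rw [h.skew x y]; simp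

theorem rotate (h : IsQgrBracket b) (x y z : A) : b (b x y) z = b (b y z) x := by
  rw [h.swap_left x, h.swap_right y, neg_neg]

theorem one_left (h : IsQgrBracket b) (x : A) : b 1 x = 0 := by
  have := h.leibniz 1 1 x
  simpa using this

/-- The monomial `[[[x, y], z], t]` is skew-symmetric in its four arguments and equal to
`[[z, t], [x, y]]`. The even permutation that exchanges the two pairs changes the sign of the
latter. -/
theorem br_br_br (h : IsQgrBracket b) (h2 : (2 : K) ≠ 0) (x y z t : A) :
    b (b (b x y) z) t = 0 := by
  refine eq_zero_of_eq_neg h2 ?_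
  have h1 : ∀ x y z t, b (b (b x y) z) t = b (b z t) (b x y) := fun x y z t => h.rotate _ z t
  have h3 : ∀ x y z t, b (b (b x y) z) t = b (b (b y z) x) t := fun x y z t => by
    rw [h.rotate x y z]
  have h4 : b (b (b z t) x) y = b (b (b x y) z) t := by
    rw [h3 z t x, h.swap_right _ z y, h3 t x y, h.swap_right (b x y) t z, neg_neg]
  calc b (b (b x y) z) t = b (b z t) (b x y) := h1 x y z t
    _ = -b (b x y) (b z t) := h.skew _ _
    _ = -b (b (b x y) z) t := by rw [← h1 z t x y, h4]

theorem br_br_right (h : IsQgrBracket b) (h2 : (2 : K) ≠ 0) (x y z t : A) :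
    b x (b y (b z t)) = 0 := by
  rw [h.skew x, h.skew y]; simp [h.br_br_br h2]

theorem br_pairs (h : IsQgrBracket b) (h2 : (2 : K) ≠ 0) (x y z t : A) :
    b (b x y) (b z t) = 0 := by
  rw [← h.rotate, h.br_br_br h2]

/-- Since `[[x · y, z], t]` is skew-symmetric in `z` and `t`, its part
`[x, t] · [y, z] + [x, z] · [y, t]`, which is symmetric, vanishes. -/
theorem mul_swap (h : IsQgrBracket b) (h2 : (2 : K) ≠ 0) (x y z t : A) :
    b x z * b y t = -(b x t * b y z) := by
  have key : b x z * b y t + b x t * b y z = 0 := by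
    refine eq_zero_of_eq_neg h2 ?_
    have h0 := h.br_br (x * y) z t
    simp only [h.leibniz, map_add, LinearMap.add_apply] at h0
    linear_combination h0 - x * h.br_br y z t - y * h.br_br x z t
  exact eq_neg_of_add_eq_zero_left key

theorem triple_mul_triple (h : IsQgrBracket b) (h2 : (2 : K) ≠ 0) (x y z x' y' z' : A) :
    b x (b y z) * b x' (b y' z') = 0 := by
  rw [h.skew x', mul_neg, h.mul_swap h2, h.skew x x', neg_neg]
  rw [h.skew (b y' z') (b y z), h.br_pairs h2]
  simp

end IsQgrBracket

/-- The product `[x₁, x₂] · [x₃, x₄] ⋯` of a list of elements; if their number is odd and at least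
three, the last factor is `[xₘ₋₂, [xₘ₋₁, xₘ]]`. For a single element the value is set to `0`,
which keeps skew-symmetry and the vanishing of products of odd length free of exceptions. -/
def bracketProd (b : A →ₗ[K] A →ₗ[K] A) : List A → A
  | [] => 1
  | [_] => 0
  | [x, y, z] => b x (b y z)
  | x :: y :: l => b x y * bracketProd b l

/-- The recursion fails for one-element lists `l`, where `bracketProd` continues with the double
bracket. -/
theorem bracketProd_cons_cons (x y : A) {l : List A} (hl : l.length ≠ 1) :
    bracketProd b (x :: y :: l) = b x y * bracketProd b l := by
  match l with
  | [] => simp [bracketProd]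
  | [z] => simp at hl
  | u :: v :: l => simp [bracketProd]

namespace IsQgrBracket

theorem bracketProd_swap (h : IsQgrBracket b) (h2 : (2 : K) ≠ 0) (x y : A) (l : List A) :
    ∀ p : List A, bracketProd b (p ++ x :: y :: l) = -bracketProd b (p ++ y :: x :: l)
  | [] => by
    match l with
    | [] => simp [bracketProd, h.skew x y]
    | [z] =>
      simp only [List.nil_append, bracketProd]
      rw [h.skew x (b y z), h.skew y (b x z), h.rotate x z y, h.swap_left z y x]
      simp
    | u :: v :: l => simp [bracketProd, h.skew x y]
  | [z] => by
    match l with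
    | [] => simp [bracketProd, h.skew x y]
    | [u] =>
      simp only [List.cons_append, List.nil_append, bracketProd, mul_one]
      rw [h.skew y u, mul_neg, h.mul_swap h2, h.skew u x]
      simp
    | [u, v] =>
      simp only [List.cons_append, List.nil_append, bracketProd]
      rw [h.skew y, mul_neg, h.mul_swap h2, h.skew _ x]
      simp
    | u :: v :: w :: l =>
      simp only [List.cons_append, List.nil_append, bracketProd]
      rw [← mul_assoc, h.skew y u, mul_neg, h.mul_swap h2, h.skew u x]
      simp [mul_assoc]
  | z :: u :: p => by
    simp only [List.cons_append]
    rw [bracketProd_cons_cons _ _ (by simp; omega), bracketProd_cons_cons _ _ (by simp; omega),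
      bracketProd_swap h h2 x y l p, mul_neg]

/-- The induction over permutations works with an arbitrary prefix, since removing the first element
of a list would change the pairing of the others. -/
theorem bracketProd_perm (h : IsQgrBracket b) (h2 : (2 : K) ≠ 0) {l l' : List A}
    (hl : l.Perm l') : bracketProd b l = bracketProd b l' ∨
      bracketProd b l = -bracketProd b l' := by
  suffices ∀ p : List A, bracketProd b (p ++ l) = bracketProd b (p ++ l') ∨
      bracketProd b (p ++ l) = -bracketProd b (p ++ l') from this []
  induction hl with
  | nil => exact fun p => Or.inl rfl
  | cons x _ ih => exact fun p => by simpa using ih (p ++ [x])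
  | swap x y l => exact fun p => Or.inr (h.bracketProd_swap h2 _ _ _ _)
  | trans _ _ ih₁ ih₂ =>
    intro p
    rcases ih₁ p with h₁ | h₁ <;> rcases ih₂ p with h₂ | h₂ <;> simp [h₁, h₂]

end IsQgrBracket

theorem bracketProd_append {l' : List A} (hl' : l'.length ≠ 1) :
    ∀ l : List A, Even l.length → bracketProd b (l ++ l') = bracketProd b l * bracketProd b l'
  | [], _ => by simp [bracketProd]
  | [_], hl => by simp at hl
  | x :: y :: l, hl => by
    have hl2 : Even l.length := by simpa [Nat.even_add_one] using hl
    have h1 : l.length ≠ 1 := fun h => by simp [h] at hl2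
    have h3 : (l ++ l').length ≠ 1 := by
      rw [List.length_append]
      rcases hl2 with ⟨k, hk⟩
      omega
    rw [List.cons_append, List.cons_append, bracketProd_cons_cons _ _ h3,
      bracketProd_cons_cons _ _ h1, bracketProd_append hl' l hl2, mul_assoc]

theorem exists_bracketProd_odd :
    ∀ l : List A, ¬Even l.length → l.length ≠ 1 → ∃ c x y z,
      bracketProd b l = c * b x (b y z)
  | [], hl, _ => by simp at hl
  | [_], _, hl => by simp at hl
  | [x, y, z], _, _ => ⟨1, x, y, z, by simp [bracketProd]⟩
  | [x, y], hl, _ => by simp at hl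
  | x :: y :: u :: v :: l, hl, _ => by
    obtain ⟨c, x', y', z', hc⟩ := exists_bracketProd_odd (u :: v :: l)
      (by simpa [Nat.even_add_one] using hl) (by
        rintro h
        simp only [List.length_cons, Nat.add_eq_right, Nat.add_eq_zero_iff] at h
        omega)
    exact ⟨b x y * c, x', y', z', by
      rw [bracketProd_cons_cons _ _ (by simp), hc, mul_assoc]⟩

theorem IsQgrBracket.bracketProd_mul_odd (h : IsQgrBracket b) (h2 : (2 : K) ≠ 0) {l l' : List A}
    (hl : ¬Even l.length) (hl' : ¬Even l'.length) :
    bracketProd b l * bracketProd b l' = 0 := by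
  by_cases h1 : l.length = 1
  · obtain ⟨x, rfl⟩ := List.length_eq_one_iff.1 h1
    simp [bracketProd]
  by_cases h1' : l'.length = 1
  · obtain ⟨x, rfl⟩ := List.length_eq_one_iff.1 h1'
    simp [bracketProd]
  obtain ⟨c, x, y, z, hc⟩ := exists_bracketProd_odd (b := b) l hl h1
  obtain ⟨c', x', y', z', hc'⟩ := exists_bracketProd_odd (b := b) l' hl' h1'
  rw [hc, hc', mul_mul_mul_comm, h.triple_mul_triple h2, mul_zero]

variable {γ : Type}

/-- The span of the products `bracketProd l · ∏ s` of values under `v` whose arguments, those in `l`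
and in `s` together, form the multiset `μ`. Lists `l` of length one are excluded, because they
carry no bracket. Counting the arguments with multiplicity avoids disjointness hypotheses. -/
def normalSpan (b : A →ₗ[K] A →ₗ[K] A) (v : γ → A) (μ : Multiset γ) : Submodule K A :=
  Submodule.span K {x | ∃ (l : List γ) (s : Multiset γ), l.length ≠ 1 ∧ (l : Multiset γ) + s = μ ∧
    x = bracketProd b (l.map v) * (s.map v).prod}

variable {v : γ → A}

theorem mem_normalSpan {l : List γ} (s : Multiset γ) (hl : l.length ≠ 1) :
    bracketProd b (l.map v) * (s.map v).prod ∈ normalSpan b v (l + s) :=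
  Submodule.subset_span ⟨l, s, hl, rfl, rfl⟩

theorem bracketProd_mem_normalSpan {l : List γ} (hl : l.length ≠ 1) :
    bracketProd b (l.map v) ∈ normalSpan b v l := by
  simpa using mem_normalSpan (b := b) (v := v) 0 hl

theorem prod_mem_normalSpan (s : Multiset γ) : (s.map v).prod ∈ normalSpan b v s := by
  simpa [bracketProd] using mem_normalSpan (b := b) (v := v) (l := []) s (by simp)

/-- Of two products of brackets, one with an even number of arguments may be put in front of the
other one; if both numbers are odd, the product vanishes. -/
theorem IsQgrBracket.mul_mem_normalSpan (h : IsQgrBracket b) (h2 : (2 : K) ≠ 0)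
    {μ ν : Multiset γ} {x y : A} (hx : x ∈ normalSpan b v μ) (hy : y ∈ normalSpan b v ν) :
    x * y ∈ normalSpan b v (μ + ν) := by
  suffices normalSpan b v μ * normalSpan b v ν ≤ normalSpan b v (μ + ν) from
    this (Submodule.mul_mem_mul hx hy)
  rw [normalSpan, normalSpan, Submodule.span_mul_span, Submodule.span_le]
  rintro _ ⟨_, ⟨l, s, hl, rfl, rfl⟩, _, ⟨l', s', hl', rfl, rfl⟩, rfl⟩
  simp only [SetLike.mem_coe]
  rw [mul_mul_mul_comm, ← Multiset.prod_add, ← Multiset.map_add, add_add_add_comm]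
  by_cases he : Even l.length
  · rw [← bracketProd_append (by simpa using hl') _ (by simpa using he), ← List.map_append,
      Multiset.coe_add]
    refine mem_normalSpan _ ?_
    rcases he with ⟨k, hk⟩
    rw [List.length_append]
    omega
  by_cases he' : Even l'.length
  · rw [mul_comm (bracketProd b _), add_comm (l : Multiset γ),
      ← bracketProd_append (by simpa using hl) _ (by simpa using he'), ← List.map_append,
      Multiset.coe_add]
    refine mem_normalSpan _ ?_
    rcases he' with ⟨k, hk⟩
    rw [List.length_append]
    omega
  · rw [h.bracketProd_mul_odd h2 (by simpa using he) (by simpa using he'), zero_mul]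
    exact Submodule.zero_mem _

/-- By the Leibniz rule, stability of the normal spans under `x ↦ [x, z]` may be checked on the
generators `a`, `[a, a']`, `[a, [a', a'']]`. -/
theorem IsQgrBracket.br_mem_normalSpan_of_generators (h : IsQgrBracket b) (h2 : (2 : K) ≠ 0)
    {z : A} {ν : Multiset γ} (h₁ : ∀ a, b (v a) z ∈ normalSpan b v ({a} + ν))
    (h₂ : ∀ a a', b (b (v a) (v a')) z ∈ normalSpan b v (↑[a, a'] + ν))
    (h₃ : ∀ a a' a'', b (b (v a) (b (v a') (v a''))) z ∈ normalSpan b v (↑[a, a', a''] + ν))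
    {μ : Multiset γ} {x : A} (hx : x ∈ normalSpan b v μ) :
    b x z ∈ normalSpan b v (μ + ν) := by
  have leib : ∀ {μ₁ μ₂ : Multiset γ} {x y : A}, x ∈ normalSpan b v μ₁ → y ∈ normalSpan b v μ₂ →
      b x z ∈ normalSpan b v (μ₁ + ν) → b y z ∈ normalSpan b v (μ₂ + ν) →
      b (x * y) z ∈ normalSpan b v (μ₁ + μ₂ + ν) := by
    intro μ₁ μ₂ x y hx hy hxz hyz
    rw [h.leibniz]
    refine Submodule.add_mem _ ?_ ?_
    · rw [add_assoc]
      exact h.mul_mem_normalSpan h2 hx hyz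
    · rw [add_right_comm]
      exact h.mul_mem_normalSpan h2 hxz hy
  have hprod : ∀ s : Multiset γ, b (s.map v).prod z ∈ normalSpan b v (s + ν) := by
    intro s
    induction s using Multiset.induction_on with
    | empty => simp [h.one_left]
    | cons a s ih =>
      rw [Multiset.map_cons, Multiset.prod_cons, ← Multiset.singleton_add]
      refine leib ?_ (prod_mem_normalSpan s) (h₁ a) ih
      simpa using prod_mem_normalSpan (b := b) (v := v) {a}
  have hbr : ∀ l : List γ, b (bracketProd b (l.map v)) z ∈ normalSpan b v (l + ν) := by
    intro l
    induction l using List.twoStepInduction with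
    | nil => simp [bracketProd, h.one_left]
    | singleton a => simp [bracketProd]
    | cons_cons a a' l ih =>
      by_cases hl : l.length = 1
      · obtain ⟨a'', rfl⟩ := List.length_eq_one_iff.1 hl
        exact h₃ a a' a''
      · rw [List.map_cons, List.map_cons, bracketProd_cons_cons _ _ (by simpa using hl)]
        have : ((a :: a' :: l : List γ) : Multiset γ) = ↑[a, a'] + (l : Multiset γ) := by
          rw [Multiset.coe_add]; rfl
        rw [this]
        refine leib ?_ (bracketProd_mem_normalSpan hl) (h₂ a a') ih
        simpa [bracketProd] using
          bracketProd_mem_normalSpan (b := b) (v := v) (l := [a, a']) (by simp)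
  suffices normalSpan b v μ ≤ (normalSpan b v (μ + ν)).comap (b.flip z) from this hx
  conv_lhs => rw [normalSpan]
  rw [Submodule.span_le]
  rintro _ ⟨l, s, hl, rfl, rfl⟩
  exact leib (bracketProd_mem_normalSpan hl) (prod_mem_normalSpan s) (hbr l) (hprod s)

theorem IsQgrBracket.br_mem_normalSpan (h : IsQgrBracket b) (h2 : (2 : K) ≠ 0)
    {μ ν : Multiset γ} {x y : A} (hx : x ∈ normalSpan b v μ) (hy : y ∈ normalSpan b v ν) :
    b x y ∈ normalSpan b v (μ + ν) := by
  have swap : ∀ {ρ : Multiset γ} {x y : A},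
      b x y ∈ normalSpan b v ρ → b y x ∈ normalSpan b v ρ := by
    intro ρ x y hxy
    rw [h.skew]
    exact Submodule.neg_mem _ hxy
  -- reduce to generators in the first argument, then in the second one; all brackets of generators
  -- of total degree at least four vanish
  refine h.br_mem_normalSpan_of_generators h2 (fun a => ?_) (fun a a' => ?_)
    (fun a a' a'' => ?_) hx
  · rw [add_comm]
    refine swap (h.br_mem_normalSpan_of_generators h2 (fun c => ?_) (fun c c' => ?_)
      (fun c c' c'' => ?_) hy)
    · have := bracketProd_mem_normalSpan (b := b) (v := v) (l := [c, a]) (by simp)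
      rwa [show bracketProd b ([c, a].map v) = b (v c) (v a) by simp [bracketProd]] at this
    · refine swap ?_
      rw [add_comm]
      exact bracketProd_mem_normalSpan (b := b) (v := v) (l := [a, c, c']) (by simp)
    · refine swap ?_
      rw [h.br_br_right h2]
      exact Submodule.zero_mem _
  · rw [add_comm]
    refine swap (h.br_mem_normalSpan_of_generators h2 (fun c => ?_) (fun c c' => ?_)
      (fun c c' c'' => ?_) hy)
    · exact bracketProd_mem_normalSpan (b := b) (v := v) (l := [c, a, a']) (by simp)
    · rw [h.br_pairs h2]
      exact Submodule.zero_mem _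
    · rw [h.br_pairs h2]
      exact Submodule.zero_mem _
  · rw [add_comm]
    refine swap (h.br_mem_normalSpan_of_generators h2 (fun c => ?_) (fun c c' => ?_)
      (fun c c' c'' => ?_) hy)
    · rw [h.br_br_right h2]
      exact Submodule.zero_mem _
    · rw [h.br_pairs h2]
      exact Submodule.zero_mem _
    · rw [h.br_pairs h2]
      exact Submodule.zero_mem _

theorem IsQgrBracket.eval_mem_normalSpan (h : IsQgrBracket b) (h2 : (2 : K) ≠ 0) (t : Term γ) :
    t.eval (LinearMap.mul K A) b v ∈ normalSpan b v t.leaves := by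
  induction t with
  | leaf a => simpa [Term.eval, Term.leaves] using prod_mem_normalSpan (b := b) (v := v) {a}
  | mul s t hs ht =>
    rw [Term.leaves, ← Multiset.coe_add]
    exact h.mul_mem_normalSpan h2 hs ht
  | br s t hs ht =>
    rw [Term.leaves, ← Multiset.coe_add]
    exact h.br_mem_normalSpan h2 hs ht

/-- Up to sign, a spanning element with the arguments `0, …, n - 1`, each occurring once, is
determined by the set `I` of the arguments in its brackets. -/
theorem IsQgrBracket.normalSpan_univ_le (h : IsQgrBracket b) (h2 : (2 : K) ≠ 0) {n : ℕ}
    (v : Fin n → A) : normalSpan b v Finset.univ.val ≤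
      Submodule.span K (Set.range fun I : {I : Finset (Fin n) // I.card ≠ 1} =>
        bracketProd b ((I.1.sort (· ≤ ·)).map v) * ∏ j ∈ I.1ᶜ, v j) := by
  rw [normalSpan, Submodule.span_le]
  rintro _ ⟨l, s, hl, hls, rfl⟩
  have hnd : ((l : Multiset (Fin n)) + s).Nodup := hls ▸ Finset.univ.nodup
  have hnl : l.Nodup := Multiset.coe_nodup.1 (Multiset.nodup_of_le (Multiset.le_add_right _ _) hnd)
  have hperm : l.Perm (l.toFinset.sort (· ≤ ·)) := by
    rw [← Multiset.coe_eq_coe, Finset.sort_eq, List.toFinset_val, hnl.dedup]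
  have hs : s = (l.toFinsetᶜ).val := by
    have hns := Multiset.nodup_of_le (Multiset.le_add_left s (l : Multiset (Fin n))) hnd
    have hdis := (Multiset.nodup_add.1 hnd).2.2
    refine (Multiset.Nodup.ext hns (Finset.nodup _)).2 fun a => ?_
    have ha : a ∈ (l : Multiset (Fin n)) + s := by simp [hls]
    rw [Multiset.mem_add, Multiset.mem_coe] at ha
    rw [Finset.mem_val, Finset.mem_compl, List.mem_toFinset]
    exact ⟨fun h1 h2 => Multiset.disjoint_left.1 hdis (Multiset.mem_coe.2 h2) h1, ha.resolve_left⟩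
  have hcard : l.toFinset.card ≠ 1 := by rwa [List.toFinset_card_of_nodup hnl]
  have hmem := Submodule.subset_span (R := K) (Set.mem_range_self
    (f := fun I : {I : Finset (Fin n) // I.card ≠ 1} =>
      bracketProd b ((I.1.sort (· ≤ ·)).map v) * ∏ j ∈ I.1ᶜ, v j) ⟨l.toFinset, hcard⟩)
  have hprod : (s.map v).prod = ∏ j ∈ l.toFinsetᶜ, v j := by rw [hs]; rfl
  rw [SetLike.mem_coe, hprod]
  rcases h.bracketProd_perm h2 (hperm.map v) with he | he
  · rw [he]
    exact hmem
  · rw [he, neg_mul]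
    exact Submodule.neg_mem _ hmem

end Unital

/-! ### The monomials of the basis -/

namespace Term

theorem leaves_rightProd {α : Type} : ∀ (l : List (Term α)) (hl : l ≠ []),
    (rightProd l hl).leaves = l.flatMap leaves
  | [], hl => absurd rfl hl
  | [c], _ => by simp [rightProd]
  | c :: d :: l, _ => by
    rw [rightProd, leaves, leaves_rightProd (d :: l)]
    rfl

theorem flatMap_leaves_brackets {α : Type} (l : List α) : (brackets l).flatMap leaves = l := by
  induction l using brackets.induct with
  | case1 => rfl
  | case2 a => rfl
  | case3 a b c => rfl
  | case4 a b l h ih => simp [brackets, leaves, ih]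

theorem flatMap_leaves_factors_perm {n : ℕ} (I : Finset (Fin n)) :
    ((sortFactors (factors I)).flatMap leaves).Perm
      (I.sort (· ≤ ·) ++ Iᶜ.sort (· ≤ ·)) := by
  refine ((List.perm_insertionSort _ _).flatMap_right _).trans ?_
  rw [factors, List.flatMap_append, flatMap_leaves_brackets, List.flatMap_map]
  simp only [leaves, List.flatMap_singleton']
  exact List.Perm.refl _

theorem sortFactors_factors_ne_nil {n : ℕ} (hn : 1 ≤ n) (I : Finset (Fin n)) :
    sortFactors (factors I) ≠ [] := by
  intro h
  have hp := flatMap_leaves_factors_perm I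
  rw [h, List.flatMap_nil] at hp
  have h0 : (⟨0, hn⟩ : Fin n) ∈ I.sort (· ≤ ·) ++ Iᶜ.sort (· ≤ ·) := by
    simp [em]
  rw [← hp.mem_iff] at h0
  exact List.not_mem_nil h0

theorem isMultilinear_rightProd_factors {n : ℕ} (I : Finset (Fin n))
    (hI : sortFactors (factors I) ≠ []) :
    (rightProd (sortFactors (factors I)) hI).IsMultilinear := by
  rw [IsMultilinear, leaves_rightProd]
  have hp := flatMap_leaves_factors_perm I
  refine ⟨hp.nodup_iff.2 ?_, fun a => hp.mem_iff.2 ?_⟩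
  · rw [List.nodup_append]
    refine ⟨Finset.sort_nodup _ _, Finset.sort_nodup _ _, ?_⟩
    rintro a ha b hb rfl
    simp only [Finset.mem_sort, Finset.mem_compl] at ha hb
    exact hb ha
  · simp [em]

end Term

open Term in
/-- The basis monomial of a set `I` of arguments. -/
def basisTree {n : ℕ} (hn : 1 ≤ n) (I : Finset (Fin n)) : Tree (Fin n) :=
  ⟨rightProd (sortFactors (factors I)) (sortFactors_factors_ne_nil hn I),
    isMultilinear_rightProd_factors I _⟩

section EvalBasis

variable {K : Type*} [Field K] {A : Type*} [AddCommGroup A] [Module K A]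
variable (m b : A →ₗ[K] A →ₗ[K] A) {M : Type*} [Monoid M]

theorem Term.map_eval_rightProd {α : Type} (v : α → A) (φ : A → M)
    (hφ : ∀ x y, φ (m x y) = φ x * φ y) : ∀ (l : List (Term α)) (hl : l ≠ []),
    φ ((rightProd l hl).eval m b v) = (l.map fun t => φ (t.eval m b v)).prod
  | [], hl => absurd rfl hl
  | [c], _ => by simp [rightProd]
  | c :: d :: l, _ => by
    rw [rightProd, eval, hφ, map_eval_rightProd v φ hφ (d :: l)]
    rfl

/-- A multiplicative function with commuting values, at the value of a basis monomial. -/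
theorem map_eval_basisTree {n : ℕ} (hn : 1 ≤ n) (I : Finset (Fin n)) (v : Fin n → A) (φ : A → M)
    (hφ : ∀ x y, φ (m x y) = φ x * φ y) (hc : ∀ x y, Commute (φ x) (φ y)) :
    φ ((basisTree hn I).1.eval m b v) =
      ((Term.brackets (I.sort (· ≤ ·))).map fun t => φ (t.eval m b v)).prod *
        ((Iᶜ.sort (· ≤ ·)).map fun j => φ (v j)).prod := by
  rw [basisTree, Term.map_eval_rightProd m b v φ hφ]
  have hp : (Term.sortFactors (Term.factors I)).Perm (Term.factors I) :=
    List.perm_insertionSort _ _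
  rw [(hp.map fun t => φ (t.eval m b v)).prod_eq', Term.factors, List.map_append,
    List.prod_append, List.map_map]
  · rfl
  · exact List.Pairwise.map _ (fun _ _ _ => hc _ _)
      (List.pairwise_of_forall (R := fun _ _ => True) fun _ _ => trivial)

end EvalBasis

theorem prod_map_eval_brackets {K : Type*} [Field K] {A : Type*} [CommRing A] [Algebra K A]
    (b : A →ₗ[K] A →ₗ[K] A) {α : Type} (v : α → A) (l : List α) (hl : l.length ≠ 1) :
    ((Term.brackets l).map fun t => t.eval (LinearMap.mul K A) b v).prod =
      bracketProd b (l.map v) := by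
  induction l using Term.brackets.induct with
  | case1 => rfl
  | case2 a => simp at hl
  | case3 x y z => simp [Term.brackets, Term.eval, bracketProd]
  | case4 x y l h ih =>
    have h1 : l.length ≠ 1 := fun h1 => by
      obtain ⟨z, rfl⟩ := List.length_eq_one_iff.1 h1
      exact h z rfl
    rw [List.map_cons, List.map_cons, bracketProd_cons_cons _ _ (by simpa using h1), ← ih h1,
      Term.brackets, List.map_cons, List.prod_cons]
    · rfl
    · exact h

/-! ### Spanning -/

section Unitization

variable {K : Type*} [Field K] {A : Type*} [NonUnitalCommRing A] [Module K A]

/-- The extension of a bracket by `[1, x] = 0` to the algebra with adjoined unit. -/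
def unitizationBracket (b : A →ₗ[K] A →ₗ[K] A) :
    Unitization K A →ₗ[K] Unitization K A →ₗ[K] Unitization K A :=
  (b.compl₁₂ (Unitization.sndHom K K A) (Unitization.sndHom K K A)).compr₂
    (Unitization.inrHom K K A)

theorem unitizationBracket_apply (b : A →ₗ[K] A →ₗ[K] A) (x y : Unitization K A) :
    unitizationBracket b x y = Unitization.inr (b x.snd y.snd) := rfl

variable [IsScalarTower K A A] [SMulCommClass K A A]

theorem IsQgr.unitization {b : A →ₗ[K] A →ₗ[K] A} (h : IsQgr (LinearMap.mul K A) b) :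
    IsQgrBracket (unitizationBracket b) where
  skew x y := by
    rw [unitizationBracket_apply, unitizationBracket_apply, h.br_skew, Unitization.inr_neg]
  br_br x y z := by
    simp only [unitizationBracket_apply, Unitization.snd_inr, ← Unitization.inr_add, h.br_br,
      Unitization.inr_zero]
  leibniz x y z := by
    have hl := h.leibniz
    simp only [LinearMap.mul_apply'] at hl
    apply Unitization.ext
    · simp [unitizationBracket_apply]
    · simp [unitizationBracket_apply, hl]
      abel

theorem eval_unitization (b : A →ₗ[K] A →ₗ[K] A) {α : Type} (v : α → A) (t : Term α) :
    t.eval (LinearMap.mul K (Unitization K A)) (unitizationBracket b)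
      (fun a => Unitization.inr (v a)) = Unitization.inr (t.eval (LinearMap.mul K A) b v) := by
  induction t with
  | leaf a => rfl
  | mul s t hs ht => simp [Term.eval, hs, ht]
  | br s t hs ht => simp [Term.eval, hs, ht, unitizationBracket_apply]

end Unitization

section Span

variable {K : Type*} [Field K]

theorem IsQgrBracket.eval_mem_span {A : Type*} [CommRing A] [Algebra K A]
    {b : A →ₗ[K] A →ₗ[K] A} (h : IsQgrBracket b) (h2 : (2 : K) ≠ 0) {n : ℕ} (hn : 1 ≤ n)
    (v : Fin n → A) (t : Tree (Fin n)) :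
    t.1.eval (LinearMap.mul K A) b v ∈
      Submodule.span K (Set.range fun I : {I : Finset (Fin n) // I.card ≠ 1} =>
        (basisTree hn I.1).1.eval (LinearMap.mul K A) b v) := by
  have ht : (t.1.leaves : Multiset (Fin n)) = Finset.univ.val :=
    (Multiset.Nodup.ext (Multiset.coe_nodup.2 t.2.1) Finset.univ.nodup).2 fun a => by
      simp [t.2.2 a]
  have hmem := h.eval_mem_normalSpan h2 (v := v) t.1
  rw [ht] at hmem
  refine Submodule.span_mono (Set.range_subset_range_iff_exists_comp.2 ⟨id, ?_⟩)
    (h.normalSpan_univ_le h2 v hmem)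
  funext I
  have he := map_eval_basisTree (LinearMap.mul K A) b hn I.1 v id (fun _ _ => rfl)
    (fun _ _ => Commute.all _ _)
  simp only [id] at he
  rw [prod_map_eval_brackets b v _ (by simpa using I.2)] at he
  rw [Function.comp_apply, id, he, ← Multiset.prod_coe, ← Multiset.map_coe, Finset.sort_eq]
  rfl

/-- In an algebra over the operad, values of multilinear monomials are linear combinations of
values of the basis monomials. -/
theorem IsQgr.eval_mem_span {A : Type*} [AddCommGroup A] [Module K A]
    {m b : A →ₗ[K] A →ₗ[K] A} (h : IsQgr m b) (h2 : (2 : K) ≠ 0) {n : ℕ} (hn : 1 ≤ n)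
    (v : Fin n → A) (t : Tree (Fin n)) :
    t.1.eval m b v ∈ Submodule.span K (Set.range fun I : {I : Finset (Fin n) // I.card ≠ 1} =>
        (basisTree hn I.1).1.eval m b v) := by
  -- the product `m` makes `A` a commutative ring without unit, to which a unit is adjoined
  let _ : NonUnitalCommRing A :=
    { ‹AddCommGroup A› with
      mul := fun x y => m x y
      left_distrib := fun x y z => map_add (m x) y z
      right_distrib := fun x y z => LinearMap.map_add₂ m x y z
      zero_mul := fun x => LinearMap.map_zero₂ m x
      mul_zero := fun x => map_zero (m x)
      mul_assoc := h.mul_assoc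
      mul_comm := h.mul_symm }
  have _ : IsScalarTower K A A := ⟨fun c x y => LinearMap.map_smul₂ m c x y⟩
  have _ : SMulCommClass K A A := ⟨fun c x y => (map_smul (m x) c y).symm⟩
  have hm : m = LinearMap.mul K A := rfl
  rw [hm] at h ⊢
  have key := h.unitization.eval_mem_span h2 hn (fun i => Unitization.inr (v i)) t
  simp only [eval_unitization] at key
  have hr : (Set.range fun I : {I : Finset (Fin n) // I.card ≠ 1} =>
      (Unitization.inr ((basisTree hn I.1).1.eval (LinearMap.mul K A) b v) : Unitization K A)) =
      Unitization.inrHom K K A '' (Set.range fun I : {I : Finset (Fin n) // I.card ≠ 1} =>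
        (basisTree hn I.1).1.eval (LinearMap.mul K A) b v) := by
    rw [← Set.range_comp]; rfl
  rw [hr, ← Submodule.map_span] at key
  obtain ⟨x, hx, hxt⟩ := key
  rwa [← Unitization.inr_injective hxt]

theorem top_le_span_basisTree (h2 : (2 : K) ≠ 0) {n : ℕ} (hn : 1 ≤ n) :
    ⊤ ≤ Submodule.span K (Set.range fun I : {I : Finset (Fin n) // I.card ≠ 1} =>
      Qgr.mono K (basisTree hn I.1).1 (basisTree hn I.1).2) := by
  have hmono : ∀ t : Tree (Fin n), Qgr.mono K t.1 t.2 ∈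
      Submodule.span K (Set.range fun I : {I : Finset (Fin n) // I.card ≠ 1} =>
        Qgr.mono K (basisTree hn I.1).1 (basisTree hn I.1).2) := by
    intro t
    have key := (FreeAlg.isQgr K (Fin n)).eval_mem_span h2 hn
      (fun c => FreeAlg.mk (QgrRel K) (Term.leaf c)) t
    simp only [← FreeAlg.mk_eq_eval] at key
    have := Submodule.mem_map_of_mem (f := FreeAlg.toQuotient (QgrRel K) (Fin n)) key
    rw [Submodule.map_span, ← Set.range_comp, FreeAlg.toQuotient_mk t.2] at this
    convert this using 1
    · congr 2
      funext I
      exact (FreeAlg.toQuotient_mk (R := QgrRel K) (basisTree hn I.1).2).symm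
    · rfl
  intro x _
  obtain ⟨x, rfl⟩ := (ideal (QgrRel K) (Fin n)).mkQ_surjective x
  induction x using Finsupp.induction_linear with
  | zero => simp
  | add x y hx hy => rw [map_add]; exact Submodule.add_mem _ (hx trivial) (hy trivial)
  | single t c =>
    rw [← mul_one c, ← smul_eq_mul, ← Finsupp.smul_single, map_smul]
    exact Submodule.smul_mem _ _ (hmono t)

end Span

/-! ### Products of vectors in the exterior algebra -/

/-- The pairing with the product of the dual coordinates is the determinant of a unit matrix. -/
theorem prod_ι_single_ne_zero (K : Type*) [Field K] {κ : Type*} {l : List κ} (hl : l.Nodup) :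
    (l.map fun k => ExteriorAlgebra.ι K (Finsupp.single k (1 : K))).prod ≠ 0 := by
  classical
  intro h
  have hp := exteriorPower.pairingDual_ιMulti_ιMulti (R := K)
    (fun i : Fin l.length => Finsupp.lapply (l.get i))
    (fun i : Fin l.length => Finsupp.single (l.get i) (1 : K))
  have h0 : exteriorPower.ιMulti K l.length
      (fun i : Fin l.length => Finsupp.single (l.get i) (1 : K)) = 0 := by
    apply Subtype.ext
    rw [exteriorPower.ιMulti_apply_coe, ExteriorAlgebra.ιMulti_apply]
    refine Eq.trans ?_ h
    congr 1
    exact List.ext_getElem (by simp) (by simp)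
  have h1 : (Matrix.of fun i j : Fin l.length =>
      Finsupp.lapply (R := K) (M := K) (l.get j) (Finsupp.single (l.get i) (1 : K))) = 1 := by
    ext i j
    simp [Matrix.one_apply, Finsupp.single_apply, hl.getElem_inj_iff, Fin.ext_iff]
  rw [h0, map_zero, h1, Matrix.det_one] at hp
  exact zero_ne_one hp

section Forms

variable {K : Type*} [Field K] {V : Type*} [AddCommGroup V] [Module K V]

variable (K V) in
/-- The even and the odd part of the exterior algebra. -/
abbrev extPart (i : ZMod 2) : Submodule K (ExteriorAlgebra K V) :=
  CliffordAlgebra.evenOdd (0 : QuadraticForm K V) i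

theorem extPart_mul_mem {i j k : ZMod 2} {x y : ExteriorAlgebra K V} (hx : x ∈ extPart K V i)
    (hy : y ∈ extPart K V j) (h : i + j = k) : x * y ∈ extPart K V k :=
  h ▸ CliffordAlgebra.evenOdd_mul_le _ i j (Submodule.mul_mem_mul hx hy)

theorem even_commute {i : ZMod 2} {x y : ExteriorAlgebra K V} (hx : x ∈ extPart K V 0)
    (hy : y ∈ extPart K V i) : x * y = y * x := by
  have := CliffordAlgebra.commute_map_mul_map_of_isOrtho_of_mem_evenOdd_zero_left
    (QuadraticMap.Isometry.id (0 : QuadraticForm K V)) (QuadraticMap.Isometry.id _)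
    (fun x y => by simp [QuadraticMap.IsOrtho]) x y hx hy
  simpa using this.eq

theorem odd_anticommute {x y : ExteriorAlgebra K V} (hx : x ∈ extPart K V 1)
    (hy : y ∈ extPart K V 1) : x * y = -(y * x) := by
  have := CliffordAlgebra.map_mul_map_eq_neg_of_isOrtho_of_mem_evenOdd_one
    (QuadraticMap.Isometry.id (0 : QuadraticForm K V)) (QuadraticMap.Isometry.id _)
    (fun x y => by simp [QuadraticMap.IsOrtho]) x y hx hy
  simpa using this

variable (K V) in
/-- The underlying space of the model: pairs of an even and an odd element of the exterior
algebra. A pair `(f, p)` is to be thought of as an even element with its differential `p = df`. -/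
abbrev Model := extPart K V 0 × extPart K V 1

/-- The product `(f, p) · (g, q) = (f g, p g + f q)` of the model. -/
noncomputable def modelMul : Model K V →ₗ[K] Model K V →ₗ[K] Model K V :=
  LinearMap.mk₂ K
    (fun x y => (⟨x.1.1 * y.1.1, extPart_mul_mem x.1.2 y.1.2 (by decide)⟩,
      ⟨x.2.1 * y.1.1 + x.1.1 * y.2.1, Submodule.add_mem _
        (extPart_mul_mem x.2.2 y.1.2 (by decide)) (extPart_mul_mem x.1.2 y.2.2 (by decide))⟩))
    (fun x x' y => by ext; · simp [add_mul]
                      · simp [add_mul]; abel)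
    (fun c x y => by ext <;> simp)
    (fun x y y' => by ext; · simp [mul_add]
                      · simp [mul_add]; abel)
    (fun c x y => by ext <;> simp)

/-- The bracket `[(f, p), (g, q)] = (p q, 2 ε p q)` of the model, for a fixed vector `ε`. -/
noncomputable def modelBr (e : V) : Model K V →ₗ[K] Model K V →ₗ[K] Model K V :=
  LinearMap.mk₂ K
    (fun x y => (⟨x.2.1 * y.2.1, extPart_mul_mem x.2.2 y.2.2 (by decide)⟩,
      ⟨(2 : K) • (ExteriorAlgebra.ι K e * (x.2.1 * y.2.1)), Submodule.smul_mem _ _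
        (extPart_mul_mem (CliffordAlgebra.ι_mem_evenOdd_one _ e)
          (extPart_mul_mem (k := 0) x.2.2 y.2.2 (by decide)) (by decide))⟩))
    (fun x x' y => by ext <;> simp [add_mul, mul_add])
    (fun c x y => by ext <;> simp [smul_comm c (2 : K)])
    (fun x y y' => by ext <;> simp [mul_add])
    (fun c x y => by ext <;> simp [smul_comm c (2 : K)])

theorem modelMul_fst (x y : Model K V) : (modelMul x y).1.1 = x.1.1 * y.1.1 := rfl

theorem modelMul_snd (x y : Model K V) :
    (modelMul x y).2.1 = x.2.1 * y.1.1 + x.1.1 * y.2.1 := rfl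

theorem modelBr_fst (e : V) (x y : Model K V) : (modelBr e x y).1.1 = x.2.1 * y.2.1 := rfl

theorem modelBr_snd (e : V) (x y : Model K V) :
    (modelBr e x y).2.1 = (2 : K) • (ExteriorAlgebra.ι K e * (x.2.1 * y.2.1)) := rfl

theorem Model.ext {x y : Model K V} (h₁ : x.1.1 = y.1.1) (h₂ : x.2.1 = y.2.1) : x = y :=
  Prod.ext (Subtype.ext h₁) (Subtype.ext h₂)

/-- Double brackets in the model are totally skew-symmetric because
`[[(f, p), (g, q)], (h, r)] = (2 ε p q r, 0)`. -/
theorem model_isQgr (e : V) : IsQgr (modelMul (K := K)) (modelBr e) where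
  mul_symm x y := by
    apply Model.ext
    · exact even_commute x.1.2 y.1.2
    · rw [modelMul_snd, modelMul_snd, even_commute x.1.2 y.2.2, ← even_commute y.1.2 x.2.2,
        add_comm]
  br_skew x y := by
    apply Model.ext
    · exact odd_anticommute x.2.2 y.2.2
    · change (modelBr e x y).2.1 = -(modelBr e y x).2.1
      rw [modelBr_snd, modelBr_snd, odd_anticommute x.2.2 y.2.2, mul_neg, smul_neg]
  br_br x y z := by
    have hs : y.2.1 * z.2.1 + z.2.1 * y.2.1 = 0 := by
      rw [odd_anticommute y.2.2 z.2.2, neg_add_cancel]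
    have h1 : (modelBr e (modelBr e x y) z + modelBr e (modelBr e x z) y).1.1 = 0 := by
      change (modelBr e x y).2.1 * z.2.1 + (modelBr e x z).2.1 * y.2.1 = 0
      rw [modelBr_snd, modelBr_snd, smul_mul_assoc, smul_mul_assoc, ← smul_add]
      simp only [mul_assoc]
      rw [← mul_add, ← mul_add, hs, mul_zero, mul_zero, smul_zero]
    apply Model.ext h1
    change (2 : K) • (ExteriorAlgebra.ι K e * _) + (2 : K) • (ExteriorAlgebra.ι K e * _) = 0
    rw [← smul_add, ← mul_add]
    exact (congrArg (fun w => (2 : K) • (ExteriorAlgebra.ι K e * w)) h1).trans (by simp)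
  leibniz x y z := by
    have hx : x.1.1 * ExteriorAlgebra.ι K e = ExteriorAlgebra.ι K e * x.1.1 :=
      even_commute x.1.2 (CliffordAlgebra.ι_mem_evenOdd_one _ e)
    have hy := even_commute y.1.2 z.2.2
    have h1 : (modelBr e (modelMul x y) z).1.1 =
        x.1.1 * (y.2.1 * z.2.1) + x.2.1 * z.2.1 * y.1.1 := by
      rw [modelBr_fst, modelMul_snd, add_mul, mul_assoc, mul_assoc, mul_assoc, hy, add_comm]
    apply Model.ext
    · exact h1
    · change (2 : K) • (ExteriorAlgebra.ι K e * (modelBr e (modelMul x y) z).1.1) =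
        (x.2.1 * (modelBr e y z).1.1 + x.1.1 * (modelBr e y z).2.1) +
          ((modelBr e x z).2.1 * y.1.1 + (modelBr e x z).1.1 * y.2.1)
      have h2 : x.2.1 * (y.2.1 * z.2.1) + x.2.1 * z.2.1 * y.2.1 = 0 := by
        rw [mul_assoc, ← mul_add, odd_anticommute y.2.2 z.2.2, neg_add_cancel, mul_zero]
      rw [h1, modelBr_snd, modelBr_snd, modelBr_fst, modelBr_fst, mul_add, smul_add,
        mul_smul_comm, ← mul_assoc x.1.1 (ExteriorAlgebra.ι K e), hx, smul_mul_assoc,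
        mul_assoc _ x.1.1, mul_assoc _ (x.2.1 * z.2.1)]
      linear_combination (norm := abel) -h2
  mul_assoc x y z := by
    apply Model.ext
    · exact mul_assoc _ _ _
    · simp only [modelMul_fst, modelMul_snd, add_mul, mul_add, mul_assoc]
      abel

end Forms

/-! ### Linear independence -/

section Independence

variable {K : Type*} [Field K] {n : ℕ}

/-- The vectors of the space with basis `ξ₁, …, ξₙ, ε`; the last one is the vector of `none`. -/
noncomputable def modelVec (K : Type*) [Field K] {n : ℕ} (k : Option (Fin n)) :
    Option (Fin n) →₀ K := Finsupp.single k 1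

/-- The assignment which singles out the basis monomial of `I`: the argument `aᵢ` is evaluated at
`(0, ξᵢ)` if `i ∈ I`, and at the unit `(1, 0)` otherwise. -/
noncomputable def modelPoint (K : Type*) [Field K] (I : Finset (Fin n)) (i : Fin n) :
    Model K (Option (Fin n) →₀ K) :=
  if i ∈ I then (0, ⟨ExteriorAlgebra.ι K (modelVec K (some i)),
      CliffordAlgebra.ι_mem_evenOdd_one _ _⟩)
    else (⟨1, Submodule.one_le.1 (CliffordAlgebra.one_le_evenOdd_zero _)⟩, 0)

theorem modelPoint_snd_of_mem {I : Finset (Fin n)} {i : Fin n} (h : i ∈ I) :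
    (modelPoint K I i).2.1 = ExteriorAlgebra.ι K (modelVec K (some i)) := by
  simp [modelPoint, h]

theorem modelPoint_fst_of_mem {I : Finset (Fin n)} {i : Fin n} (h : i ∈ I) :
    (modelPoint K I i).1.1 = 0 := by
  simp [modelPoint, h]

theorem modelPoint_fst_of_notMem {I : Finset (Fin n)} {i : Fin n} (h : i ∉ I) :
    (modelPoint K I i).1.1 = 1 := by
  simp [modelPoint, h]

theorem modelPoint_snd_of_notMem {I : Finset (Fin n)} {i : Fin n} (h : i ∉ I) :
    (modelPoint K I i).2.1 = 0 := by
  simp [modelPoint, h]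

/-- Here `v a` has differential `0`, and the even component of a bracket that involves
`a` is a product with this factor. -/
theorem prod_brackets_eq_zero {V : Type*} [AddCommGroup V] [Module K V] (e : V) {α : Type}
    (v : α → Model K V) {a : α} (ha : (v a).2.1 = 0) (l : List α) (hl : l.length ≠ 1)
    (hal : a ∈ l) :
    ((Term.brackets l).map fun t => (t.eval modelMul (modelBr e) v).1.1).prod = 0 := by
  induction l using Term.brackets.induct with
  | case1 => simp at hal
  | case2 a => simp at hl
  | case3 x y z =>
    simp only [Term.brackets, List.map_cons, List.map_nil, List.prod_singleton, Term.eval,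
      modelBr_fst, modelBr_snd]
    simp only [List.mem_cons, List.not_mem_nil, or_false] at hal
    rcases hal with rfl | rfl | rfl <;> simp [ha]
  | case4 x y l h ih =>
    have h1 : l.length ≠ 1 := fun h1 => by
      obtain ⟨z, rfl⟩ := List.length_eq_one_iff.1 h1
      exact h z rfl
    rw [Term.brackets, List.map_cons, List.prod_cons, Term.eval, modelBr_fst]
    · simp only [List.mem_cons] at hal
      rcases hal with rfl | rfl | hal
      · simp [Term.eval, ha]
      · simp [Term.eval, ha]
      · rw [ih h1 hal, mul_zero]
    · exact h

/-- At odd differentials `ξₐ`, the product of the brackets of `l` is the product of the `ξₐ`,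
with an additional factor `2 ε` if the length is odd. The list `L` consists of the indices of these
vectors, `none` being that of `ε`. -/
theorem exists_prod_brackets_eq (h2 : (2 : K) ≠ 0) (v : Fin n → Model K (Option (Fin n) →₀ K))
    (l : List (Fin n)) (hv : ∀ i ∈ l, (v i).2.1 = ExteriorAlgebra.ι K (modelVec K (some i)))
    (hl : l.length ≠ 1) (hn : l.Nodup) :
    ∃ (c : K) (L : List (Option (Fin n))), c ≠ 0 ∧ L.Nodup ∧ (∀ i, some i ∈ L → i ∈ l) ∧
      ((Term.brackets l).map fun t =>
        (t.eval modelMul (modelBr (modelVec K none)) v).1.1).prod =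
      c • (L.map fun k => ExteriorAlgebra.ι K (modelVec K k)).prod := by
  induction l using Term.brackets.induct with
  | case1 => exact ⟨1, [], one_ne_zero, by simp, by simp, by simp [Term.brackets]⟩
  | case2 a => simp at hl
  | case3 x y z =>
    refine ⟨2, [some x, none, some y, some z], h2, ?_, by simp, ?_⟩
    · simpa using hn
    · simp only [Term.brackets, List.map_cons, List.map_nil, List.prod_cons, List.prod_nil,
        Term.eval, modelBr_fst, modelBr_snd, mul_one]
      rw [hv x (by simp), hv y (by simp), hv z (by simp), mul_smul_comm]
  | case4 x y l h ih =>
    have h1 : l.length ≠ 1 := fun h1 => by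
      obtain ⟨z, rfl⟩ := List.length_eq_one_iff.1 h1
      exact h z rfl
    simp only [List.nodup_cons, List.mem_cons, not_or] at hn
    obtain ⟨c, L, hc, hL, hsub, he⟩ := ih (fun i hi => hv i (by simp [hi])) h1 hn.2.2
    refine ⟨c, some x :: some y :: L, hc, ?_, ?_, ?_⟩
    · simp only [List.nodup_cons, List.mem_cons, not_or, Option.some_inj]
      exact ⟨⟨hn.1.1, fun hx => hn.1.2 (hsub x hx)⟩, fun hy => hn.2.1 (hsub y hy), hL⟩
    · intro i hi
      simp only [List.mem_cons, Option.some_inj] at hi ⊢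
      exact hi.imp_right (Or.imp_right (hsub i))
    · rw [Term.brackets, List.map_cons, List.prod_cons, he]
      · simp only [Term.eval, modelBr_fst, List.map_cons, List.prod_cons]
        rw [hv x (by simp), hv y (by simp), mul_smul_comm, mul_assoc]
      · exact h

/-- The even component of the value of the basis monomial of `J` at the point of `I`. -/
theorem eval_basisTree_modelPoint (hn : 1 ≤ n) (I J : Finset (Fin n)) :
    ((basisTree hn J).1.eval modelMul (modelBr (modelVec K none)) (modelPoint K I)).1.1 =
      ((Term.brackets (J.sort (· ≤ ·))).map fun t =>
        (t.eval modelMul (modelBr (modelVec K none)) (modelPoint K I)).1.1).prod *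
        ((Jᶜ.sort (· ≤ ·)).map fun j => (modelPoint K I j).1.1).prod :=
  map_eval_basisTree modelMul (modelBr (modelVec K none)) hn J (modelPoint K I)
    (fun x => x.1.1) modelMul_fst (fun x y => even_commute x.1.2 y.1.2)

theorem eval_basisTree_of_ne (hn : 1 ≤ n) {I J : Finset (Fin n)} (hJ : J.card ≠ 1) (h : J ≠ I) :
    ((basisTree hn J).1.eval modelMul (modelBr (modelVec K none)) (modelPoint K I)).1.1 = 0 := by
  rw [eval_basisTree_modelPoint]
  by_cases hs : J ⊆ I
  · -- some `i ∈ I` is a factor of its own, and `(0, ξᵢ)` has even component `0`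
    obtain ⟨i, hi, hiJ⟩ := Finset.exists_of_ssubset (hs.ssubset_of_ne h)
    have h0 : ((Jᶜ.sort (· ≤ ·)).map fun j => (modelPoint K I j).1.1).prod = 0 := by
      apply List.prod_eq_zero
      rw [List.mem_map]
      exact ⟨i, by simpa using hiJ, modelPoint_fst_of_mem hi⟩
    rw [h0, mul_zero]
  · -- some `i ∉ I` occurs in a bracket, and the odd component of `(1, 0)` is `0`
    obtain ⟨i, hi, hiI⟩ := Finset.not_subset.1 hs
    rw [prod_brackets_eq_zero _ _ (modelPoint_snd_of_notMem hiI) _ (by simpa using hJ)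
      (by simpa using hi), zero_mul]

theorem eval_basisTree_self (h2 : (2 : K) ≠ 0) (hn : 1 ≤ n) {I : Finset (Fin n)}
    (hI : I.card ≠ 1) :
    ((basisTree hn I).1.eval modelMul (modelBr (modelVec K none)) (modelPoint K I)).1.1 ≠ 0 := by
  rw [eval_basisTree_modelPoint]
  have h1 : ((Iᶜ.sort (· ≤ ·)).map fun j => (modelPoint K I j).1.1).prod = 1 := by
    apply List.prod_eq_one
    intro x hx
    obtain ⟨j, hj, rfl⟩ := List.mem_map.1 hx
    exact modelPoint_fst_of_notMem (by simpa using hj)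
  obtain ⟨c, L, hc, hL, -, he⟩ := exists_prod_brackets_eq h2 (modelPoint K I) (I.sort (· ≤ ·))
    (fun i hi => modelPoint_snd_of_mem (by simpa using hi)) (by simpa using hI)
    (Finset.sort_nodup _ _)
  rw [h1, mul_one, he]
  exact smul_ne_zero hc (prod_ι_single_ne_zero K hL)

/-- The even component of the value at the point of `I`, as a functional on the operad. -/
noncomputable def Qgr.modelEval (I : Finset (Fin n)) :
    Qgr K n →ₗ[K] ExteriorAlgebra K (Option (Fin n) →₀ K) :=
  (ideal (QgrRel K) (Fin n)).liftQ
    ((extPart K (Option (Fin n) →₀ K) 0).subtype ∘ₗ LinearMap.fst K _ _ ∘ₗ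
      Free.eval modelMul (modelBr (modelVec K none)) (modelPoint K I)) fun x hx => by
    rw [LinearMap.mem_ker, LinearMap.comp_apply, LinearMap.comp_apply,
      (model_isQgr _).eval_eq_zero hx, map_zero, map_zero]

theorem Qgr.modelEval_mono (I : Finset (Fin n)) (t : Term (Fin n)) (ht : t.IsMultilinear) :
    Qgr.modelEval I (Qgr.mono K t ht) =
      (t.eval modelMul (modelBr (modelVec K none)) (modelPoint K I)).1.1 := by
  change ((Free.eval modelMul (modelBr (modelVec K none)) (modelPoint K I)
    (Free.mono K t ht)).1.1) = _
  rw [Free.eval_mono]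

theorem linearIndependent_basisTree (h2 : (2 : K) ≠ 0) (hn : 1 ≤ n) :
    LinearIndependent K fun I : {I : Finset (Fin n) // I.card ≠ 1} =>
      Qgr.mono K (basisTree hn I.1).1 (basisTree hn I.1).2 := by
  rw [Fintype.linearIndependent_iff]
  intro g hg I
  have := congrArg (Qgr.modelEval I.1) hg
  rw [map_sum, map_zero, Finset.sum_eq_single I] at this
  · rw [map_smul, Qgr.modelEval_mono] at this
    exact (smul_eq_zero.1 this).resolve_right (eval_basisTree_self h2 hn I.2)
  · intro J _ hJ
    rw [map_smul, Qgr.modelEval_mono,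
      eval_basisTree_of_ne hn J.2 (fun h => hJ (Subtype.ext h)), smul_zero]
  · simp

end Independence

theorem card_subtype_card_ne_one (n : ℕ) :
    Fintype.card {I : Finset (Fin n) // I.card ≠ 1} = 2 ^ n - n := by
  rw [Fintype.card_subtype_compl, Fintype.card_finset, Fintype.card_fin,
    Fintype.card_finset_len, Fintype.card_fin, Nat.choose_one_right]

end DualAlt

theorem mainTheorem2 (K : Type*) [Field K] (hK : ringChar K ≠ 2) (n : ℕ) (hn : 1 ≤ n) :
    Module.finrank K (DualAlt.Qgr K n) = 2 ^ n - n ∧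
    ∃ b : Module.Basis {I : Finset (Fin n) // I.card ≠ 1} K (DualAlt.Qgr K n),
      ∀ I : {I : Finset (Fin n) // I.card ≠ 1},
        ∃ (hI : DualAlt.Term.sortFactors (DualAlt.Term.factors I.1) ≠ [])
          (ht : (DualAlt.Term.rightProd
            (DualAlt.Term.sortFactors (DualAlt.Term.factors I.1)) hI).IsMultilinear),
          b I = DualAlt.Qgr.mono K (DualAlt.Term.rightProd
            (DualAlt.Term.sortFactors (DualAlt.Term.factors I.1)) hI) ht := by
  have h2 : (2 : K) ≠ 0 := Ring.two_ne_zero hK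
  let b := Module.Basis.mk (DualAlt.linearIndependent_basisTree h2 hn)
    (DualAlt.top_le_span_basisTree h2 hn)
  refine ⟨?_, b, fun I => ⟨DualAlt.Term.sortFactors_factors_ne_nil hn I.1,
    (DualAlt.basisTree hn I.1).2, Module.Basis.mk_apply _ _ I⟩⟩
  rw [Module.finrank_eq_card_basis b, DualAlt.card_subtype_card_ne_one]
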